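/- Let $d$ be a natural number, let $\langle\cdot,\cdot\rangle$ be the $L^2$ pairing (linear in the first argument, conjugate linear in the second), extended to $\mathcal S'\times\mathcal S$, and let $M_\eta T_xg(y)=e^{2\pi i y\cdot\eta}g(y-x)$. For a nonzero window $g\in\mathcal S(\mathbb R^n)$ and $u\in\mathcal S'(\mathbb R^n)$ put $V_gu(x,\eta)=\langle u,M_\eta T_xg\rangle$. For $p\in\{1,\infty\}$, $M^p(\mathbb R^n)$ is the space of $u\in\mathcal S'(\mathbb R^n)$ with $V_gu\in L^p(\mathbb R^{2n})$, with norm $\|u\|_{M^p}=\|V_gu\|_{L^p}$, and $\mathcal M^p(\mathbb R^n)$ is the closure of $\mathcal S(\mathbb R^n)$ in this norm. A phase $\Phi:\mathbb R^{2d}\to\mathbb R$ is called tame if it is $C^\infty$, all its partial derivatives of order at least $2$ are bounded, and there is $\delta>0$ with $\bigl|\det\bigl(\partial^2\Phi/\partial x_i\partial\eta_l\,(x,\eta)\bigr)\bigr|\ge\delta$ for all $(x,\eta)\in\mathbb R^{2d}$. For $\sigma\in\mathcal S'(\mathbb R^{2d})$ the Fourier integral operator $T_\sigma:\mathcal S(\mathbb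 R^d)\to\mathcal S'(\mathbb R^d)$, $$T_\sigma f(x)=\int_{\mathbb R^d}e^{2\pi i\Phi(x,\eta)}\sigma(x,\eta)\hat f(\eta)\,d\eta ,\qquad \hat f(\eta)=\int_{\mathbb R^d}f(x)e^{-2\pi i x\cdot\eta}\,dx,$$ is understood in the distributional sense: the distribution $T_\sigma f$ takes a test function $\varphi\in\mathcal S(\mathbb R^d)$ to the value of $\sigma$ at $e^{2\pi i\Phi}(\varphi\otimes\hat f)$. **Proposition.** Let $\Phi$ be a tame phase, let $g_1,g_2\in\mathcal S(\mathbb R^d)\setminus\{0\}$ be windows used to compute the norms of $M^\infty(\mathbb R^d)$ and $M^1(\mathbb R^d)$ respectively, and let $\gamma\in\mathcal S(\mathbb R^{2d})\setminus\{0\}$ be a window used to compute the norm of $M^1(\mathbb R^{2d})$. There is a constant $C\ge 0$, depending only on $d$, $\Phi$, $g_1$, $g_2$, $\gamma$, such that for every $\sigma\in M^1(\mathbb R^{2d})$: 1. $T_\sigma$ extends to a bounded linear operator from $\mathcal M^\infty(\mathbb R^d)$ to $\mathcal M^1(\mathbb R^d)$, with $$\|T_\sigma u\|_{\mathcal M^1(\mathbb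 R^d)}\le C\,\|\sigma\|_{M^1(\mathbb R^{2d})}\,\|u\|_{\mathcal M^\infty(\mathbb R^d)},\qquad u\in\mathcal M^\infty(\mathbb R^d).$$ 2. The Gabor matrix $(x',\eta',x,\eta)\mapsto\langle T_\sigma(M_\eta T_xg_1),M_{\eta'}T_{x'}g_2\rangle$ belongs to $L^1(\mathbb R^{4d})$, with norm at most $C\,\|\sigma\|_{M^1(\mathbb R^{2d})}$. -/

import Mathlib

open MeasureTheory SchwartzMap
open scoped ENNReal NNReal ContDiff FourierTransform

noncomputable section

section TimeFrequency

variable {V : Type*} [NormedAddCommGroup V] [InnerProductSpace ℝ V]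

/-- The time-frequency shift `M_ξ T_x g`, that is `y ↦ exp (2πi y·ξ) g (y - x)`. -/
def timeFreqShift (x ξ : V) (g : 𝓢(V, ℂ)) : 𝓢(V, ℂ) :=
  SchwartzMap.smulLeftCLM ℂ
    (fun y : V => Complex.exp (2 * Real.pi * Complex.I * (inner ℝ y ξ : ℝ)))
    (SchwartzMap.compSubConstCLM ℂ x g)

/-- Complex conjugation of a Schwartz function. -/
def conjSchwartz (φ : 𝓢(V, ℂ)) : 𝓢(V, ℂ) :=
  SchwartzMap.postcompCLM (𝕜 := ℝ) (Complex.conjCLE : ℂ →L[ℝ] ℂ) φ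

/-- The pairing `⟨u, φ⟩` of a tempered distribution with a Schwartz function, linear in `u` and
conjugate linear in `φ`, which extends the inner product of `L²`. -/
def sesqPairing (u : 𝓢'(V, ℂ)) (φ : 𝓢(V, ℂ)) : ℂ := u (conjSchwartz φ)

/-- The short-time Fourier transform `V_g u (x, ξ) = ⟨u, M_ξ T_x g⟩`. -/
def stft (g : 𝓢(V, ℂ)) (u : 𝓢'(V, ℂ)) (z : V × V) : ℂ :=
  sesqPairing u (timeFreqShift z.1 z.2 g)

theorem stft_add (g : 𝓢(V, ℂ)) (u v : 𝓢'(V, ℂ)) : stft g (u + v) = stft g u + stft g v := rfl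

theorem stft_smul (g : 𝓢(V, ℂ)) (c : ℂ) (u : 𝓢'(V, ℂ)) : stft g (c • u) = c • stft g u := rfl

theorem stft_zero (g : 𝓢(V, ℂ)) : stft g (0 : 𝓢'(V, ℂ)) = 0 := rfl

variable [FiniteDimensional ℝ V] [MeasurableSpace V] [BorelSpace V]

/-- The norm of `M^p = M^{p,p}`, computed with the window `g`: the `L^p` norm of the short-time
Fourier transform. -/
def modNorm (g : 𝓢(V, ℂ)) (p : ℝ≥0∞) (u : 𝓢'(V, ℂ)) : ℝ≥0∞ := eLpNorm (stft g u) p volume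

/-- The modulation space `M^p = M^{p,p}`: the tempered distributions whose short-time Fourier
transform (with window `g`) is in `L^p`. -/
def modSpace (g : 𝓢(V, ℂ)) (p : ℝ≥0∞) : Submodule ℂ 𝓢'(V, ℂ) where
  carrier := {u | MemLp (stft g u) p volume}
  add_mem' hu hv := by
    rw [Set.mem_ofPred_eq, stft_add]
    exact MemLp.add hu hv
  zero_mem' := by
    rw [Set.mem_ofPred_eq, stft_zero]
    exact MemLp.zero
  smul_mem' c u hu := by
    rw [Set.mem_ofPred_eq, stft_smul]
    exact MemLp.const_smul hu c

/-- The closure of the Schwartz space in the norm of `M^p`: the distributions `u` for which some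
Schwartz function `φ` has `u - φ ∈ M^p` and `‖u - φ‖_{M^p} < ε`, for every `ε > 0`. As Schwartz functions are in `M^p`, every such `u` is in `M^p`. -/
def modSpaceClosure (g : 𝓢(V, ℂ)) (p : ℝ≥0∞) [hp : Fact (1 ≤ p)] : Submodule ℂ 𝓢'(V, ℂ) where
  carrier := {u | ∀ ε : ℝ≥0∞, 0 < ε → ∃ φ : 𝓢(V, ℂ),
    u - (φ : 𝓢'(V, ℂ)) ∈ modSpace g p ∧ modNorm g p (u - (φ : 𝓢'(V, ℂ))) < ε}
  add_mem' {u v} hu hv ε hε := by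
    obtain ⟨φ, hφ, hφ'⟩ := hu (ε / 2) (ENNReal.half_pos hε.ne')
    obtain ⟨ψ, hψ, hψ'⟩ := hv (ε / 2) (ENNReal.half_pos hε.ne')
    have h : u + v - ((φ + ψ : 𝓢(V, ℂ)) : 𝓢'(V, ℂ)) =
        (u - (φ : 𝓢'(V, ℂ))) + (v - (ψ : 𝓢'(V, ℂ))) := by
      rw [map_add]; abel
    refine ⟨φ + ψ, ?_, ?_⟩
    · rw [h]
      exact (modSpace g p).add_mem hφ hψ
    · rw [h]
      calc modNorm g p ((u - (φ : 𝓢'(V, ℂ))) + (v - (ψ : 𝓢'(V, ℂ))))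
          ≤ modNorm g p (u - (φ : 𝓢'(V, ℂ))) + modNorm g p (v - (ψ : 𝓢'(V, ℂ))) := by
            unfold modNorm
            rw [stft_add]
            exact eLpNorm_add_le hφ.1 hψ.1 hp.out
        _ < ε / 2 + ε / 2 := ENNReal.add_lt_add hφ' hψ'
        _ = ε := ENNReal.add_halves ε
  zero_mem' ε hε := by
    refine ⟨0, ?_, ?_⟩
    · rw [map_zero, sub_zero]
      exact (modSpace g p).zero_mem
    · rw [map_zero, sub_zero, modNorm, stft_zero, eLpNorm_zero]
      exact hε
  smul_mem' c u hu ε hε := by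
    have hc : ‖c‖ₑ + 1 ≠ ⊤ := by finiteness
    obtain ⟨φ, hφ, hφ'⟩ := hu (ε / (‖c‖ₑ + 1)) (ENNReal.div_pos hε.ne' hc)
    have h : c • u - ((c • φ : 𝓢(V, ℂ)) : 𝓢'(V, ℂ)) = c • (u - (φ : 𝓢'(V, ℂ))) := by
      rw [map_smul, smul_sub]
    refine ⟨c • φ, ?_, ?_⟩
    · rw [h]
      exact (modSpace g p).smul_mem c hφ
    · rw [h, modNorm, stft_smul, eLpNorm_const_smul]
      calc ‖c‖ₑ * eLpNorm (stft g (u - (φ : 𝓢'(V, ℂ)))) p volume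
          ≤ (‖c‖ₑ + 1) * eLpNorm (stft g (u - (φ : 𝓢'(V, ℂ)))) p volume := by
            gcongr
            exact le_self_add
        _ < (‖c‖ₑ + 1) * (ε / (‖c‖ₑ + 1)) :=
            (ENNReal.mul_lt_mul_iff_right (by simp) hc).2 hφ'
        _ = ε := ENNReal.mul_div_cancel (by simp) hc

/-- Schwartz functions belong to the closure of the Schwartz space. -/
theorem coe_mem_modSpaceClosure (g : 𝓢(V, ℂ)) (p : ℝ≥0∞) [Fact (1 ≤ p)] (f : 𝓢(V, ℂ)) :
    (f : 𝓢'(V, ℂ)) ∈ modSpaceClosure g p := by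
  intro ε hε
  refine ⟨f, ?_, ?_⟩
  · rw [sub_self]
    exact (modSpace g p).zero_mem
  · rw [sub_self, modNorm, stft_zero, eLpNorm_zero]
    exact hε

end TimeFrequency

section Fio

/-- The Euclidean space `ℝ^d`. -/
abbrev Rd (d : ℕ) : Type := EuclideanSpace ℝ (Fin d)

/-- The Euclidean space `ℝ^{2d}`, whose points are the pairs `(x, η)` with `x, η ∈ ℝ^d`. -/
abbrev Rdd (d : ℕ) : Type := WithLp 2 (Rd d × Rd d)

variable {d : ℕ}

/-- The mixed Hessian `(∂²Φ / ∂x_i ∂η_l)` at the point `z = (x, η)`. -/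
def mixedHessian (Φ : Rdd d → ℝ) (z : Rdd d) : Matrix (Fin d) (Fin d) ℝ :=
  Matrix.of fun i l => iteratedFDeriv ℝ 2 Φ z
    ![WithLp.toLp 2 (EuclideanSpace.single i 1, 0), WithLp.toLp 2 (0, EuclideanSpace.single l 1)]

/-- Tame phase functions: real-valued smooth functions on `ℝ^{2d}` with bounded derivatives of
every order at least two, and with a mixed Hessian whose determinant is bounded away from zero. -/
structure IsTame (Φ : Rdd d → ℝ) : Prop where
  smooth : ContDiff ℝ ∞ Φ
  bounded : ∀ n : ℕ, 2 ≤ n → ∃ C : ℝ, ∀ z, ‖iteratedFDeriv ℝ n Φ z‖ ≤ C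
  nondegenerate : ∃ δ : ℝ, 0 < δ ∧ ∀ z, δ ≤ |(mixedHessian Φ z).det|

/-- A smooth map whose derivative has temperate growth has temperate growth. -/
theorem hasTemperateGrowth_of_fderiv {E F : Type*} [NormedAddCommGroup E] [NormedSpace ℝ E]
    [NormedAddCommGroup F] [NormedSpace ℝ F] {f : E → F} (hf : Differentiable ℝ f)
    (h : Function.HasTemperateGrowth (fderiv ℝ f)) : Function.HasTemperateGrowth f := by
  obtain ⟨k, C, hC⟩ := h.2 0
  have hC0 : 0 ≤ C := by
    have := (norm_nonneg _).trans (hC 0)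
    simpa using this
  refine Function.HasTemperateGrowth.of_fderiv h hf (k := k + 1) (C := ‖f 0‖ + C) fun x => ?_
  have h1 : ‖f x - f 0‖ ≤ C * (1 + ‖x‖) ^ k * ‖x - 0‖ := by
    refine Convex.norm_image_sub_le_of_norm_fderiv_le (𝕜 := ℝ) (s := Metric.closedBall 0 ‖x‖)
      (fun y _ => hf y) (fun y hy => ?_) (convex_closedBall 0 ‖x‖) (by simp) (by simp)
    have h2 := hC y
    rw [norm_iteratedFDeriv_zero] at h2
    have h3 : ‖y‖ ≤ ‖x‖ := by simpa using hy
    refine h2.trans ?_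
    gcongr
  have h4 : ‖f x‖ ≤ ‖f 0‖ + ‖f x - f 0‖ := by
    have := norm_add_le (f 0) (f x - f 0)
    rwa [add_sub_cancel] at this
  have h5 : (1 : ℝ) ≤ (1 + ‖x‖) ^ (k + 1) := one_le_pow₀ (by simp)
  calc ‖f x‖ ≤ ‖f 0‖ * 1 + C * (1 + ‖x‖) ^ k * ‖x‖ := by
        rw [sub_zero] at h1
        linarith
    _ ≤ ‖f 0‖ * (1 + ‖x‖) ^ (k + 1) + C * (1 + ‖x‖) ^ k * (1 + ‖x‖) := by
        gcongr
        simp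
    _ = (‖f 0‖ + C) * (1 + ‖x‖) ^ (k + 1) := by ring

/-- Tame phase functions have temperate growth. -/
theorem IsTame.hasTemperateGrowth {Φ : Rdd d → ℝ} (hΦ : IsTame Φ) :
    Function.HasTemperateGrowth Φ := by
  have h1 : ContDiff ℝ ∞ (fderiv ℝ Φ) := hΦ.smooth.fderiv_right (by simp)
  have h2 : ContDiff ℝ ∞ (fderiv ℝ (fderiv ℝ Φ)) := h1.fderiv_right (by simp)
  refine hasTemperateGrowth_of_fderiv (hΦ.smooth.differentiable (by simp)) ?_
  refine hasTemperateGrowth_of_fderiv (h1.differentiable (by simp)) ⟨h2, fun n => ?_⟩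
  obtain ⟨C, hC⟩ := hΦ.bounded (n + 2) (by omega)
  refine ⟨0, C, fun z => ?_⟩
  rw [norm_iteratedFDeriv_fderiv, norm_iteratedFDeriv_fderiv, pow_zero, mul_one]
  exact hC z

/-- The oscillating factor `exp (2πi Φ)`. -/
def phaseFactor (Φ : Rdd d → ℝ) (z : Rdd d) : ℂ :=
  Complex.exp (2 * Real.pi * Complex.I * (Φ z : ℝ))

/-- For a tame phase `Φ`, multiplication by `exp (2πi Φ)` acts on the Schwartz space. -/
theorem IsTame.phaseFactor_hasTemperateGrowth {Φ : Rdd d → ℝ} (hΦ : IsTame Φ) :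
    Function.HasTemperateGrowth (phaseFactor Φ) := by
  have hexp : Function.HasTemperateGrowth
      (fun t : ℝ => Complex.exp (2 * Real.pi * Complex.I * (t : ℂ))) := by
    have hd : ∀ t : ℝ, HasDerivAt (fun t : ℝ => Complex.exp (2 * Real.pi * Complex.I * (t : ℂ)))
        (2 * Real.pi * Complex.I * Complex.exp (2 * Real.pi * Complex.I * (t : ℂ))) t := by
      intro t
      have h1 : HasDerivAt (fun t : ℝ => 2 * Real.pi * Complex.I * (t : ℂ))
          (2 * Real.pi * Complex.I * 1) t :=
        (Complex.ofRealCLM.hasDerivAt (x := t)).const_mul (2 * Real.pi * Complex.I)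
      have h2 := h1.cexp
      rwa [mul_one, mul_comm (Complex.exp _)] at h2
    have hn : ∀ n : ℕ, iteratedDeriv n
        (fun t : ℝ => Complex.exp (2 * Real.pi * Complex.I * (t : ℂ))) = fun t : ℝ =>
          (2 * Real.pi * Complex.I) ^ n * Complex.exp (2 * Real.pi * Complex.I * (t : ℂ)) := by
      intro n
      induction n with
      | zero => simp
      | succ n ih =>
        rw [iteratedDeriv_succ, ih]
        funext t
        rw [((hd t).const_mul _).deriv]
        ring
    refine ⟨(contDiff_const.mul Complex.ofRealCLM.contDiff).cexp, fun n =>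
      ⟨0, (2 * Real.pi) ^ n, fun t => ?_⟩⟩
    rw [norm_iteratedFDeriv_eq_norm_iteratedDeriv, hn]
    have h3 : ‖Complex.exp (2 * Real.pi * Complex.I * (t : ℂ))‖ = 1 := by
      have := Complex.norm_exp_ofReal_mul_I (2 * Real.pi * t)
      rw [← this]
      congr 2
      push_cast
      ring
    rw [norm_mul, h3, norm_pow]
    simp [abs_of_pos Real.pi_pos]
  exact hexp.comp hΦ.hasTemperateGrowth

/-- The tensor product `φ ⊗ ψ`, that is `(x, η) ↦ φ x * ψ η`, as a continuous linear function of
the Schwartz function `φ`. -/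
def tensorCLM (ψ : 𝓢(Rd d, ℂ)) : 𝓢(Rd d, ℂ) →L[ℂ] 𝓢(Rdd d, ℂ) :=
  SchwartzMap.mkCLM (fun φ z => φ z.fst * ψ z.snd)
    (fun φ φ' z => by simp [add_mul]) (fun c φ z => by simp [mul_assoc])
    (fun φ => ((φ.smooth ⊤).comp (WithLp.fstL 2 ℝ (Rd d) (Rd d)).contDiff).mul
      ((ψ.smooth ⊤).comp (WithLp.sndL 2 ℝ (Rd d) (Rd d)).contDiff)) <| by
  rintro ⟨k, n⟩
  set L₁ := WithLp.fstL 2 ℝ (Rd d) (Rd d)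
  set L₂ := WithLp.sndL 2 ℝ (Rd d) (Rd d)
  set q : ℝ := 2 ^ k * (Finset.Iic (k, n)).sup (fun m => SchwartzMap.seminorm ℂ m.1 m.2) ψ with hq
  have hq0 : 0 ≤ q := by positivity
  refine ⟨Finset.Iic (k, n), ∑ i ∈ Finset.range (n + 1),
    (n.choose i : ℝ) * ‖L₁‖ ^ i * ‖L₂‖ ^ (n - i) * 2 ^ k * q, by positivity, fun φ z => ?_⟩
  set s : ℝ := (Finset.Iic (k, n)).sup (schwartzSeminormFamily ℂ (Rd d) ℂ) φ with hs
  have hcomp : ∀ (L : Rdd d →L[ℝ] Rd d) (f : 𝓢(Rd d, ℂ)) (i : ℕ),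
      ‖iteratedFDeriv ℝ i (f ∘ L) z‖ ≤ ‖iteratedFDeriv ℝ i f (L z)‖ * ‖L‖ ^ i := by
    intro L f i
    rw [L.iteratedFDeriv_comp_right (f.smooth ⊤) z (mod_cast le_top)]
    refine (ContinuousMultilinearMap.norm_compContinuousLinearMap_le _ _).trans ?_
    simp
  have hz : ‖z‖ ≤ (1 + ‖L₁ z‖) * (1 + ‖L₂ z‖) := by
    have h1 : ‖z‖ ^ 2 = ‖L₁ z‖ ^ 2 + ‖L₂ z‖ ^ 2 := WithLp.prod_norm_sq_eq_of_L2 z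
    have h2 := norm_nonneg (L₁ z)
    have h3 := norm_nonneg (L₂ z)
    refine le_of_sq_le_sq ?_ (by positivity)
    rw [h1]
    nlinarith [mul_nonneg h2 h3, mul_nonneg (mul_nonneg h2 h3) h2,
      mul_nonneg (mul_nonneg h2 h3) h3, mul_nonneg (mul_nonneg h2 h3) (mul_nonneg h2 h3)]
  have hmul := norm_iteratedFDeriv_mul_le (𝕜 := ℝ) (N := ∞) (n := n)
    ((φ.smooth ⊤).comp L₁.contDiff) ((ψ.smooth ⊤).comp L₂.contDiff) z (mod_cast le_top)
  calc ‖z‖ ^ k * ‖iteratedFDeriv ℝ n (fun z : Rdd d => φ z.fst * ψ z.snd) z‖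
      ≤ ((1 + ‖L₁ z‖) * (1 + ‖L₂ z‖)) ^ k * ∑ i ∈ Finset.range (n + 1), (n.choose i : ℝ) *
          ‖iteratedFDeriv ℝ i (φ ∘ L₁) z‖ * ‖iteratedFDeriv ℝ (n - i) (ψ ∘ L₂) z‖ := by
        gcongr
        exact hmul
    _ ≤ ∑ i ∈ Finset.range (n + 1),
          (n.choose i : ℝ) * ‖L₁‖ ^ i * ‖L₂‖ ^ (n - i) * 2 ^ k * q * s := by
        rw [Finset.mul_sum]
        refine Finset.sum_le_sum fun i hi => ?_
        have hi' : i ≤ n := by simpa [Nat.lt_succ_iff] using hi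
        have hφ : (1 + ‖L₁ z‖) ^ k * ‖iteratedFDeriv ℝ i φ (L₁ z)‖ ≤ 2 ^ k * s :=
          SchwartzMap.one_add_le_sup_seminorm_apply (𝕜 := ℂ) (m := (k, n)) le_rfl hi' φ (L₁ z)
        have hψ : (1 + ‖L₂ z‖) ^ k * ‖iteratedFDeriv ℝ (n - i) ψ (L₂ z)‖ ≤ q :=
          SchwartzMap.one_add_le_sup_seminorm_apply (𝕜 := ℂ) (m := (k, n)) le_rfl
            (Nat.sub_le n i) ψ (L₂ z)
        calc ((1 + ‖L₁ z‖) * (1 + ‖L₂ z‖)) ^ k * ((n.choose i : ℝ) *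
              ‖iteratedFDeriv ℝ i (φ ∘ L₁) z‖ * ‖iteratedFDeriv ℝ (n - i) (ψ ∘ L₂) z‖)
            ≤ ((1 + ‖L₁ z‖) * (1 + ‖L₂ z‖)) ^ k * ((n.choose i : ℝ) *
              (‖iteratedFDeriv ℝ i φ (L₁ z)‖ * ‖L₁‖ ^ i) *
              (‖iteratedFDeriv ℝ (n - i) ψ (L₂ z)‖ * ‖L₂‖ ^ (n - i))) := by
              gcongr
              · exact hcomp L₁ φ i
              · exact hcomp L₂ ψ (n - i)
          _ = (n.choose i : ℝ) * ‖L₁‖ ^ i * ‖L₂‖ ^ (n - i) *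
              ((1 + ‖L₁ z‖) ^ k * ‖iteratedFDeriv ℝ i φ (L₁ z)‖) *
              ((1 + ‖L₂ z‖) ^ k * ‖iteratedFDeriv ℝ (n - i) ψ (L₂ z)‖) := by
            rw [mul_pow]
            ring
          _ ≤ (n.choose i : ℝ) * ‖L₁‖ ^ i * ‖L₂‖ ^ (n - i) * (2 ^ k * s) * q := by gcongr
          _ = (n.choose i : ℝ) * ‖L₁‖ ^ i * ‖L₂‖ ^ (n - i) * 2 ^ k * q * s := by ring
    _ = _ := by rw [Finset.sum_mul]

@[simp]
theorem tensorCLM_apply (ψ φ : 𝓢(Rd d, ℂ)) (z : Rdd d) :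
    tensorCLM ψ φ z = φ z.fst * ψ z.snd := rfl

/-- The Fourier integral operator `T_σ f (x) = ∫ exp (2πi Φ(x,η)) σ(x,η) f̂(η) dη` with phase `Φ`
and symbol `σ ∈ 𝓢'(ℝ^{2d})`, from `𝓢(ℝ^d)` to `𝓢'(ℝ^d)`, in the sense of distributions:
`φ ↦ σ (exp (2πi Φ) (φ ⊗ f̂))`. -/
def fio (Φ : Rdd d → ℝ) (σ : 𝓢'(Rdd d, ℂ)) (f : 𝓢(Rd d, ℂ)) : 𝓢'(Rd d, ℂ) :=
  PointwiseConvergenceCLM.precomp ℂ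
    (SchwartzMap.smulLeftCLM ℂ (phaseFactor Φ) ∘L tensorCLM (𝓕 f)) σ

theorem fio_apply (Φ : Rdd d → ℝ) (σ : 𝓢'(Rdd d, ℂ)) (f φ : 𝓢(Rd d, ℂ)) :
    fio Φ σ f φ = σ (SchwartzMap.smulLeftCLM ℂ (phaseFactor Φ) (tensorCLM (𝓕 f) φ)) := rfl

/-- The Gabor matrix `⟨T_σ (M_η T_x g₁), M_{η'} T_{x'} g₂⟩` of the operator `T_σ`, as a function of
`((x', η'), (x, η)) ∈ ℝ^{4d}`. -/
def gaborMatrix (Φ : Rdd d → ℝ) (σ : 𝓢'(Rdd d, ℂ)) (g₁ g₂ : 𝓢(Rd d, ℂ))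
    (w : (Rd d × Rd d) × (Rd d × Rd d)) : ℂ :=
  sesqPairing (fio Φ σ (timeFreqShift w.2.1 w.2.2 g₁)) (timeFreqShift w.1.1 w.1.2 g₂)

end Fio

end

/-! Up to a unimodular factor, the Gabor matrix entry at `((x', η'), (x, η))` is a short-time
Fourier transform of `σ` itself. Expand `Φ` to first order at `z = (x', η)`. The constant term gives
a phase, the linear term shifts the frequency, and what remains multiplies `g₂ ⊗ conj (𝓕 g₁)` to
form a window depending on `z`. The entry thus samples `σ` at the point `(z, ζ)` with `ζ = (η', x) -
∇Φ(z)` (`IsTame.norm_gaborMatrix_eq`). Since all derivatives of `Φ` of order at least two are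
bounded, these windows stay in a bounded subset of the Schwartz space
(`IsTame.exists_seminorm_defectFactor_le`).

Changing to the fixed window `γ` dominates the entry by the convolution of `|V_γ σ|` with one
integrable weight, evaluated at `(z, ζ)`. For fixed `z` the map `(η', x) ↦ ζ` is a translation, so
sampling preserves measure, and Tonelli gives the `L¹` bound on the Gabor matrix
(`IsTame.exists_lintegral_gaborMatrix_le`).

The extension holds for any continuous operator `A` with integrable Gabor matrix
(`exists_extension_of_integrable_operatorGaborMatrix`). Put `T u = ‖g₁‖⁻² ∫ V_{g₁}u(z) A(π(z) g₁)
dz` weakly, where `π(z)` is the time-frequency shift and the norm is that of `L²`. Testing against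
shifts of `g₂` bounds the `M¹` norm by the `M^∞` norm of `u` times the `L¹` norm of the matrix. On
Schwartz functions `T = A` because the inversion formula converges in the Schwartz space and so
commutes with continuous functionals (`exists_schwartz_integral`). Finally `T u` lies in the closure
of the Schwartz space because that space is dense in `M¹` (`modSpace_one_le_modSpaceClosure`). -/

noncomputable section

/-! ### Continuous seminorms on the Schwartz space. -/

section ContinuousSeminorms

/-- Nonnegative combinations of continuous seminorms are continuous seminorms. -/
theorem exists_seminorm_eq_mul_sum {G ι : Type*} [AddCommGroup G] [Module ℝ G]
    [TopologicalSpace G] (s : Finset ι) {q : ι → Seminorm ℝ G} (hq : ∀ i, Continuous (q i)) {C : ℝ}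
    (hC : 0 ≤ C) : ∃ p : Seminorm ℝ G, Continuous p ∧ ∀ f, p f = C * ∑ i ∈ s, q i f := by
  lift C to ℝ≥0 using hC
  have h : ∀ f, (C • ∑ i ∈ s, q i : Seminorm ℝ G) f = C * ∑ i ∈ s, q i f := by
    intro f
    rw [smul_apply, sum_apply]
    rfl
  refine ⟨C • ∑ i ∈ s, q i, ?_, h⟩
  rw [funext h]
  exact (continuous_finsetSum _ fun i _ => hq i).const_mul _

variable {E : Type*} [NormedAddCommGroup E] [NormedSpace ℝ E]

/-- The standard seminorms of the Schwartz space are continuous. -/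
theorem continuous_schwartz_seminorm (k n : ℕ) :
    Continuous (SchwartzMap.seminorm ℝ k n : Seminorm ℝ 𝓢(E, ℂ)) :=
  (schwartz_withSeminorms ℝ E ℂ).continuous_seminorm (k, n)

/-- Weighted derivatives of Schwartz functions are controlled by continuous seminorms. -/
theorem exists_seminorm_one_add_pow_mul_le (k n : ℕ) :
    ∃ q : Seminorm ℝ 𝓢(E, ℂ), Continuous q ∧ ∀ (f : 𝓢(E, ℂ)) (x : E),
      (1 + ‖x‖) ^ k * ‖iteratedFDeriv ℝ n f x‖ ≤ q f := by
  obtain ⟨q, hq, hq'⟩ := exists_seminorm_eq_mul_sum (Finset.Iic (k, n))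
    (fun i => continuous_schwartz_seminorm (E := E) i.1 i.2) (by positivity : (0 : ℝ) ≤ 2 ^ k)
  refine ⟨q, hq, fun f x => ?_⟩
  refine (one_add_le_sup_seminorm_apply (𝕜 := ℝ) (m := (k, n)) le_rfl le_rfl f x).trans ?_
  have h1 := Seminorm.finset_sup_le_sum (fun m : ℕ × ℕ =>
    (SchwartzMap.seminorm ℝ m.1 m.2 : Seminorm ℝ 𝓢(E, ℂ))) (Finset.Iic (k, n)) f
  rw [sum_apply] at h1
  rw [hq']
  gcongr

/-- A continuous seminorm on the Schwartz space is bounded by a finite sum of the standard ones. -/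
theorem exists_le_sum_schwartz_seminorm {q : Seminorm ℝ 𝓢(E, ℂ)} (hq : Continuous q) :
    ∃ (s : Finset (ℕ × ℕ)) (C : ℝ), 0 ≤ C ∧ ∀ f,
      q f ≤ C * ∑ i ∈ s, SchwartzMap.seminorm ℝ i.1 i.2 f := by
  obtain ⟨s, C, -, h⟩ := Seminorm.bound_of_continuous (schwartz_withSeminorms ℝ E ℂ) q hq
  refine ⟨s, C, C.2, fun f => (h f).trans ?_⟩
  have h1 := Seminorm.finset_sup_le_sum (schwartzSeminormFamily ℝ E ℂ) s f
  rw [sum_apply] at h1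
  rw [smul_apply, NNReal.smul_def, smul_eq_mul]
  gcongr
  exact h1

/-- Domination of a family of maps by a continuous seminorm can be checked on the standard
seminorms. -/
theorem exists_seminorm_comp_le {G ι : Type*} [AddCommGroup G] [Module ℝ G] [TopologicalSpace G]
    [IsTopologicalAddGroup G] [ContinuousConstSMul ℝ G]
    {A : ι → G → 𝓢(E, ℂ)} {c : ι → ℝ} (hc : ∀ i, 0 ≤ c i)
    (h : ∀ k n, ∃ q : Seminorm ℝ G, Continuous q ∧ ∀ i f,
      c i * SchwartzMap.seminorm ℝ k n (A i f) ≤ q f)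
    {p : Seminorm ℝ 𝓢(E, ℂ)} (hp : Continuous p) :
    ∃ q : Seminorm ℝ G, Continuous q ∧ ∀ i f, c i * p (A i f) ≤ q f := by
  obtain ⟨s, C, hC, hs⟩ := exists_le_sum_schwartz_seminorm hp
  choose q hq hq' using h
  obtain ⟨r, hr, hr'⟩ := exists_seminorm_eq_mul_sum s (fun j => hq j.1 j.2) hC
  refine ⟨r, hr, fun i f => ?_⟩
  rw [hr']
  calc c i * p (A i f) ≤ c i * (C * ∑ j ∈ s, SchwartzMap.seminorm ℝ j.1 j.2 (A i f)) := by
          gcongr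
          · exact hc i
          · exact hs _
      _ = C * ∑ j ∈ s, c i * SchwartzMap.seminorm ℝ j.1 j.2 (A i f) := by
          rw [← Finset.mul_sum]; ring
      _ ≤ C * ∑ j ∈ s, q j.1 j.2 f := by
          gcongr with j
          exact hq' _ _ i f

end ContinuousSeminorms

/-! ### Translations: polynomial growth and joint continuity. -/

section Translation

variable {E : Type*} [NormedAddCommGroup E] [NormedSpace ℝ E]

/-- Submultiplicativity of the weight: polynomial weights pass from a point to its translate at a
polynomial cost in the shift. -/
theorem one_add_norm_le_mul_one_add_norm_sub {E : Type*} [NormedAddCommGroup E] (x a : E) :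
    1 + ‖x‖ ≤ (1 + ‖a‖) * (1 + ‖x - a‖) := by
  have h : ‖x‖ ≤ ‖x - a‖ + ‖a‖ := by simpa using norm_add_le (x - a) a
  nlinarith [mul_nonneg (norm_nonneg a) (norm_nonneg (x - a))]

theorem iteratedFDeriv_compSubConstCLM (a : E) (f : 𝓢(E, ℂ)) (n : ℕ) (x : E) :
    iteratedFDeriv ℝ n (compSubConstCLM ℂ a f) x = iteratedFDeriv ℝ n f (x - a) := by
  have h : (compSubConstCLM ℂ a f : E → ℂ) = fun x => f (x - a) := rfl
  rw [h, iteratedFDeriv_comp_sub]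

/-- Translations grow at most polynomially on the Schwartz space. -/
theorem exists_seminorm_compSubConstCLM_le {p : Seminorm ℝ 𝓢(E, ℂ)} (hp : Continuous p) :
    ∃ (k : ℕ) (q : Seminorm ℝ 𝓢(E, ℂ)), Continuous q ∧ ∀ a f,
      p (compSubConstCLM ℂ a f) ≤ (1 + ‖a‖) ^ k * q f := by
  obtain ⟨s, C, hC, hs⟩ := exists_le_sum_schwartz_seminorm hp
  choose q hq hq' using fun k n => exists_seminorm_one_add_pow_mul_le (E := E) k n
  obtain ⟨r, hr, hr'⟩ := exists_seminorm_eq_mul_sum s (fun j => hq j.1 j.2) hC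
  -- The exponent is the largest polynomial weight among the finitely many seminorms that control
  -- `p`.
  refine ⟨s.sup Prod.fst, r, hr, fun a f => ?_⟩
  · rw [hr']
    refine (hs _).trans ?_
    have key : ∀ j ∈ s, SchwartzMap.seminorm ℝ j.1 j.2 (compSubConstCLM ℂ a f) ≤
        (1 + ‖a‖) ^ s.sup Prod.fst * q j.1 j.2 f := by
      intro j hj
      have hk : j.1 ≤ s.sup Prod.fst := Finset.le_sup (f := Prod.fst) hj
      have h0 : 0 ≤ q j.1 j.2 f := apply_nonneg _ _
      refine SchwartzMap.seminorm_le_bound ℝ _ _ _ (by positivity) fun x => ?_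
      rw [iteratedFDeriv_compSubConstCLM]
      calc ‖x‖ ^ j.1 * ‖iteratedFDeriv ℝ j.2 f (x - a)‖
          ≤ ((1 + ‖a‖) * (1 + ‖x - a‖)) ^ j.1 * ‖iteratedFDeriv ℝ j.2 f (x - a)‖ := by
            gcongr
            exact (by linarith : ‖x‖ ≤ 1 + ‖x‖).trans (one_add_norm_le_mul_one_add_norm_sub x a)
        _ = (1 + ‖a‖) ^ j.1 *
            ((1 + ‖x - a‖) ^ j.1 * ‖iteratedFDeriv ℝ j.2 f (x - a)‖) := by
            rw [mul_pow, mul_assoc]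
        _ ≤ (1 + ‖a‖) ^ s.sup Prod.fst * q j.1 j.2 f := by
            gcongr
            · exact le_add_of_nonneg_right (norm_nonneg _)
            · exact hq' _ _ _ _
    calc C * ∑ j ∈ s, SchwartzMap.seminorm ℝ j.1 j.2 (compSubConstCLM ℂ a f)
        ≤ C * ∑ j ∈ s, (1 + ‖a‖) ^ s.sup Prod.fst * q j.1 j.2 f := by
          gcongr with j hj
          exact key j hj
      _ = _ := by
          rw [← Finset.mul_sum]
          ring

/-- Small translations are close to the identity on the Schwartz space. -/
theorem exists_seminorm_compSubConstCLM_sub_le (k n : ℕ) :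
    ∃ q : Seminorm ℝ 𝓢(E, ℂ), Continuous q ∧ ∀ a f,
      SchwartzMap.seminorm ℝ k n (compSubConstCLM ℂ a f - f) ≤ ‖a‖ * (1 + ‖a‖) ^ k * q f := by
  obtain ⟨q, hq, hq'⟩ := exists_seminorm_one_add_pow_mul_le (E := E) k (n + 1)
  refine ⟨q, hq, fun a f => ?_⟩
  have h0 : 0 ≤ q f := apply_nonneg _ _
  refine SchwartzMap.seminorm_le_bound ℝ _ _ _ (by positivity) fun x => ?_
  have hsub : iteratedFDeriv ℝ n (compSubConstCLM ℂ a f - f : 𝓢(E, ℂ)) x =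
      iteratedFDeriv ℝ n f (x - a) - iteratedFDeriv ℝ n f x := by
    have h : ((compSubConstCLM ℂ a f - f : 𝓢(E, ℂ)) : E → ℂ) = (compSubConstCLM ℂ a f) - f := by
      ext; rfl
    rw [h, iteratedFDeriv_sub_apply ((SchwartzMap.smooth _ n).contDiffAt)
      ((SchwartzMap.smooth _ n).contDiffAt), iteratedFDeriv_compSubConstCLM]
  have hd : Differentiable ℝ (iteratedFDeriv ℝ n f) :=
    (f.smooth ⊤).differentiable_iteratedFDeriv (mod_cast WithTop.coe_lt_top n)
  have hM : ‖iteratedFDeriv ℝ n f (x - a) - iteratedFDeriv ℝ n f x‖ ≤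
      ((1 + ‖a‖) ^ k * q f / (1 + ‖x‖) ^ k) * ‖x - a - x‖ := by
    -- On this ball the weights at `x` and at `y` differ by at most `(1 + ‖a‖) ^ k`, so the decay of
    -- the next derivative gives a bound that is uniform over the ball.
    refine Convex.norm_image_sub_le_of_norm_fderiv_le (𝕜 := ℝ) (s := Metric.closedBall x ‖a‖)
      (fun y _ => hd y) (fun y hy => ?_) (convex_closedBall x ‖a‖)
      (Metric.mem_closedBall_self (norm_nonneg _)) (by simp)
    rw [norm_fderiv_iteratedFDeriv, le_div_iff₀ (by positivity)]
    have hxy : ‖x - y‖ ≤ ‖a‖ := by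
      rw [← dist_eq_norm, dist_comm]
      exact hy
    calc ‖iteratedFDeriv ℝ (n + 1) f y‖ * (1 + ‖x‖) ^ k
        ≤ ‖iteratedFDeriv ℝ (n + 1) f y‖ * ((1 + ‖a‖) * (1 + ‖y‖)) ^ k := by
          gcongr
          refine (one_add_norm_le_mul_one_add_norm_sub x (x - y)).trans ?_
          rw [sub_sub_cancel]
          gcongr
      _ = (1 + ‖a‖) ^ k * ((1 + ‖y‖) ^ k * ‖iteratedFDeriv ℝ (n + 1) f y‖) := by
          rw [mul_pow]; ring
      _ ≤ (1 + ‖a‖) ^ k * q f := by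
          gcongr
          exact hq' f y
  rw [hsub]
  calc ‖x‖ ^ k * ‖iteratedFDeriv ℝ n f (x - a) - iteratedFDeriv ℝ n f x‖
      ≤ (1 + ‖x‖) ^ k * (((1 + ‖a‖) ^ k * q f / (1 + ‖x‖) ^ k) * ‖a‖) := by
        have h2 : ‖x - a - x‖ = ‖a‖ := by simp
        rw [h2] at hM
        gcongr
        linarith
    _ = ‖a‖ * (1 + ‖a‖) ^ k * q f := by
        field_simp

open Filter Topology in
/-- Convergence in the Schwartz space, in terms of the standard seminorms. -/
theorem tendsto_schwartz_nhds_iff {ι : Type*} {l : Filter ι} {u : ι → 𝓢(E, ℂ)} {f : 𝓢(E, ℂ)} :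
    Tendsto u l (𝓝 f) ↔
      ∀ k n, Tendsto (fun i => SchwartzMap.seminorm ℝ k n (u i - f)) l (𝓝 0) := by
  rw [(schwartz_withSeminorms ℝ E ℂ).tendsto_nhds]
  constructor
  · intro h k n
    rw [Metric.tendsto_nhds]
    intro ε hε
    filter_upwards [h (k, n) ε hε] with i hi
    simpa [abs_of_nonneg (apply_nonneg (SchwartzMap.seminorm ℝ k n) (u i - f))] using hi
  · intro h i ε hε
    exact (h i.1 i.2).eventually_lt_const hε

/-- Translation is jointly continuous on the Schwartz space. -/
theorem continuous_compSubConstCLM :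
    Continuous fun z : E × 𝓢(E, ℂ) => compSubConstCLM ℂ z.1 z.2 := by
  rw [continuous_iff_continuousAt]
  rintro ⟨a, f⟩
  rw [ContinuousAt, tendsto_schwartz_nhds_iff]
  intro k n
  obtain ⟨m, q, hq, hq'⟩ :=
    exists_seminorm_compSubConstCLM_le (continuous_schwartz_seminorm (E := E) k n)
  obtain ⟨r, hr, hr'⟩ := exists_seminorm_compSubConstCLM_sub_le (E := E) k n
  have hbound : ∀ z : E × 𝓢(E, ℂ),
      SchwartzMap.seminorm ℝ k n (compSubConstCLM ℂ z.1 z.2 - compSubConstCLM ℂ a f) ≤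
      (1 + ‖z.1‖) ^ m * q (z.2 - f) +
        ‖z.1 - a‖ * (1 + ‖z.1 - a‖) ^ k * r (compSubConstCLM ℂ a f) := by
    intro z
    -- One term carries the change of function under a translation of controlled size, the other a
    -- small translation of a fixed function.
    have h : compSubConstCLM ℂ z.1 z.2 - compSubConstCLM ℂ a f =
        compSubConstCLM ℂ z.1 (z.2 - f) +
        (compSubConstCLM ℂ (z.1 - a) (compSubConstCLM ℂ a f) - compSubConstCLM ℂ a f) := by
      rw [map_sub, compSubConstCLM_comp, add_sub_cancel]
      abel
    rw [h]
    exact (map_add_le_add _ _ _).trans (add_le_add (hq' _ _) (hr' _ _))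
  refine squeeze_zero (fun _ => apply_nonneg _ _) hbound ?_
  have hc : Continuous fun z : E × 𝓢(E, ℂ) => (1 + ‖z.1‖) ^ m * q (z.2 - f) +
        ‖z.1 - a‖ * (1 + ‖z.1 - a‖) ^ k * r (compSubConstCLM ℂ a f) := by
    have h1 : Continuous fun z : E × 𝓢(E, ℂ) => q (z.2 - f) :=
      hq.comp (continuous_snd.sub continuous_const)
    fun_prop
  have h0 := hc.tendsto (a, f)
  simpa using h0

end Translation

/-! ### Modulations and time-frequency shifts. -/

section Modulation

variable {V : Type*} [NormedAddCommGroup V] [InnerProductSpace ℝ V]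

/-- The characters `t ↦ exp (2πi t)` and all their derivatives are bounded. -/
theorem norm_iteratedFDeriv_cexp_two_pi (n : ℕ) (t : ℝ) :
    ‖iteratedFDeriv ℝ n (fun t : ℝ => Complex.exp (2 * Real.pi * Complex.I * (t : ℂ))) t‖ =
      (2 * Real.pi) ^ n := by
  have hd : ∀ t : ℝ, HasDerivAt (fun t : ℝ => Complex.exp (2 * Real.pi * Complex.I * (t : ℂ)))
      (2 * Real.pi * Complex.I * Complex.exp (2 * Real.pi * Complex.I * (t : ℂ))) t := by
    intro t
    have h1 : HasDerivAt (fun t : ℝ => 2 * Real.pi * Complex.I * (t : ℂ))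
        (2 * Real.pi * Complex.I * 1) t :=
      (Complex.ofRealCLM.hasDerivAt (x := t)).const_mul (2 * Real.pi * Complex.I)
    have h2 := h1.cexp
    rwa [mul_one, mul_comm (Complex.exp _)] at h2
  have hn : iteratedDeriv n
      (fun t : ℝ => Complex.exp (2 * Real.pi * Complex.I * (t : ℂ))) = fun t : ℝ =>
        (2 * Real.pi * Complex.I) ^ n * Complex.exp (2 * Real.pi * Complex.I * (t : ℂ)) := by
    induction n with
    | zero => simp
    | succ n ih =>
      rw [iteratedDeriv_succ, ih]
      funext t
      rw [((hd t).const_mul _).deriv]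
      ring
  have h3 : ‖Complex.exp (2 * Real.pi * Complex.I * (t : ℂ))‖ = 1 := by
    rw [← Complex.norm_exp_ofReal_mul_I (2 * Real.pi * t)]
    congr 2
    push_cast
    ring
  rw [norm_iteratedFDeriv_eq_norm_iteratedDeriv, hn, norm_mul, h3, norm_pow]
  simp [abs_of_pos Real.pi_pos]

theorem contDiff_cexp_two_pi :
    ContDiff ℝ ∞ (fun t : ℝ => Complex.exp (2 * Real.pi * Complex.I * (t : ℂ))) :=
  (contDiff_const.mul Complex.ofRealCLM.contDiff).cexp

theorem hasTemperateGrowth_cexp_two_pi :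
    Function.HasTemperateGrowth (fun t : ℝ => Complex.exp (2 * Real.pi * Complex.I * (t : ℂ))) :=
  ⟨contDiff_cexp_two_pi, fun n => ⟨0, (2 * Real.pi) ^ n, fun t => by
    rw [norm_iteratedFDeriv_cexp_two_pi]; simp⟩⟩

theorem hasTemperateGrowth_cexp_inner (ξ : V) :
    Function.HasTemperateGrowth
      (fun y : V => Complex.exp (2 * Real.pi * Complex.I * (inner ℝ y ξ : ℝ))) :=
  hasTemperateGrowth_cexp_two_pi.comp (Function.hasTemperateGrowth_inner_left ξ)

theorem norm_cexp_two_pi (t : ℝ) : ‖Complex.exp (2 * Real.pi * Complex.I * (t : ℂ))‖ = 1 := by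
  rw [← Complex.norm_exp_ofReal_mul_I (2 * Real.pi * t)]
  congr 2
  push_cast
  ring

theorem timeFreqShift_apply (x ξ : V) (g : 𝓢(V, ℂ)) (y : V) :
    timeFreqShift x ξ g y =
      Complex.exp (2 * Real.pi * Complex.I * (inner ℝ y ξ : ℝ)) * g (y - x) := by
  rw [timeFreqShift, smulLeftCLM_apply_apply (hasTemperateGrowth_cexp_inner ξ),
    compSubConstCLM_apply, smul_eq_mul]

theorem conjSchwartz_apply (φ : 𝓢(V, ℂ)) (y : V) :
    conjSchwartz φ y = starRingEnd ℂ (φ y) := rfl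

/-- Modulations are conjugate to translations under the Fourier transform, so this factorization
reduces continuity and growth of time-frequency shifts to the estimates for translations. -/
theorem timeFreqShift_eq (x ξ : V) (g : 𝓢(V, ℂ)) :
    timeFreqShift x ξ g = Complex.exp (2 * Real.pi * Complex.I * (inner ℝ x ξ : ℝ)) •
      compSubConstCLM ℂ x (timeFreqShift 0 ξ g) := by
  ext y
  rw [timeFreqShift_apply, smul_apply, compSubConstCLM_apply, timeFreqShift_apply, sub_zero,
    smul_eq_mul, ← mul_assoc, ← Complex.exp_add]
  congr 2
  rw [inner_sub_left]
  push_cast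
  ring

variable [FiniteDimensional ℝ V] [MeasurableSpace V] [BorelSpace V]

/-- The Fourier transform turns modulations into translations. -/
theorem fourier_timeFreqShift_zero (ξ : V) (g : 𝓢(V, ℂ)) :
    𝓕 (timeFreqShift 0 ξ g) = compSubConstCLM ℂ ξ (𝓕 g) := by
  ext w
  rw [compSubConstCLM_apply, fourier_coe, fourier_coe, Real.fourier_eq', Real.fourier_eq']
  congr 1 with v
  rw [timeFreqShift_apply, sub_zero, smul_eq_mul, smul_eq_mul, ← mul_assoc, ← Complex.exp_add]
  congr 2
  rw [inner_sub_right]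
  push_cast
  ring

theorem timeFreqShift_zero_eq (ξ : V) (g : 𝓢(V, ℂ)) :
    timeFreqShift 0 ξ g = 𝓕⁻ (compSubConstCLM ℂ ξ (𝓕 g)) := by
  rw [← fourier_timeFreqShift_zero, FourierTransform.fourierInv_fourier_eq]

/-- Time-frequency shifts depend continuously on the shift. -/
theorem continuous_timeFreqShift (g : 𝓢(V, ℂ)) :
    Continuous fun z : V × V => timeFreqShift z.1 z.2 g := by
  simp_rw [fun z : V × V => timeFreqShift_eq z.1 z.2 g, timeFreqShift_zero_eq]
  have h1 : Continuous fun z : V × V => (𝓕⁻ (compSubConstCLM ℂ z.2 (𝓕 g)) : 𝓢(V, ℂ)) :=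
    (FourierTransform.fourierInvCLM ℂ 𝓢(V, ℂ)).continuous.comp
      (continuous_compSubConstCLM.comp (continuous_snd.prodMk continuous_const))
  have h2 := continuous_compSubConstCLM.comp (continuous_fst.prodMk h1)
  have h3 : Continuous fun z : V × V =>
      Complex.exp (2 * Real.pi * Complex.I * (inner ℝ z.1 z.2 : ℝ)) := by fun_prop
  exact h3.smul h2

/-- Time-frequency shifts grow at most polynomially. -/
theorem exists_seminorm_timeFreqShift_le (g : 𝓢(V, ℂ)) {p : Seminorm ℝ 𝓢(V, ℂ)}
    (hp : Continuous p) :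
    ∃ (m : ℕ) (C : ℝ), 0 ≤ C ∧ ∀ x ξ,
      p (timeFreqShift x ξ g) ≤ C * ((1 + ‖x‖) ^ m * (1 + ‖ξ‖) ^ m) := by
  have hsm : ∀ (c : ℂ), ‖c‖ = 1 → ∀ (q : ℕ × ℕ) (f : 𝓢(V, ℂ)),
      SchwartzMap.seminorm ℝ q.1 q.2 (c • f) = SchwartzMap.seminorm ℝ q.1 q.2 f := by
    intro c hc q f
    have h : SchwartzMap.seminorm ℂ q.1 q.2 (c • f) = SchwartzMap.seminorm ℂ q.1 q.2 f := by
      rw [map_smul_eq_mul, hc, one_mul]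
    exact h
  -- A real seminorm need not ignore the complex unimodular factor of `timeFreqShift_eq`; the
  -- standard seminorms do, so `p` is first replaced by a combination of them.
  obtain ⟨s, C, hC, hs⟩ := exists_le_sum_schwartz_seminorm hp
  obtain ⟨r, hr, hr'⟩ := exists_seminorm_eq_mul_sum s
    (fun i => continuous_schwartz_seminorm (E := V) i.1 i.2) hC
  obtain ⟨k, q, hq, hq'⟩ := exists_seminorm_compSubConstCLM_le hr
  let Finv : 𝓢(V, ℂ) →L[ℝ] 𝓢(V, ℂ) := FourierTransform.fourierInvCLM ℝ 𝓢(V, ℂ)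
  have hq2 : Continuous (q.comp (Finv : 𝓢(V, ℂ) →ₗ[ℝ] 𝓢(V, ℂ))) := hq.comp Finv.continuous
  obtain ⟨l, t, ht, ht'⟩ := exists_seminorm_compSubConstCLM_le hq2
  have ht0 : 0 ≤ t (𝓕 g) := apply_nonneg _ _
  refine ⟨max k l, t (𝓕 g), by positivity, fun x ξ => ?_⟩
  have h1 : p (timeFreqShift x ξ g) ≤ r (compSubConstCLM ℂ x (timeFreqShift 0 ξ g)) := by
    refine (hs _).trans_eq ?_
    rw [hr']
    congr 1
    refine Finset.sum_congr rfl fun i _ => ?_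
    rw [timeFreqShift_eq, hsm _ (norm_cexp_two_pi _)]
  have h2 : r (compSubConstCLM ℂ x (timeFreqShift 0 ξ g)) ≤
      (1 + ‖x‖) ^ k * ((1 + ‖ξ‖) ^ l * t (𝓕 g)) := by
    refine (hq' x _).trans ?_
    gcongr
    rw [timeFreqShift_zero_eq]
    exact ht' ξ (𝓕 g)
  calc p (timeFreqShift x ξ g) ≤ (1 + ‖x‖) ^ k * ((1 + ‖ξ‖) ^ l * t (𝓕 g)) :=
        h1.trans h2
    _ ≤ (1 + ‖x‖) ^ max k l * ((1 + ‖ξ‖) ^ max k l * t (𝓕 g)) := by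
        gcongr
        · exact le_add_of_nonneg_right (norm_nonneg _)
        · exact le_max_left _ _
        · exact le_add_of_nonneg_right (norm_nonneg _)
        · exact le_max_right _ _
    _ = _ := by ring

end Modulation

/-! ### Integrals with values in the Schwartz space. -/

section WeakIntegral

open scoped BoundedContinuousFunction

variable {E : Type*} [NormedAddCommGroup E] [NormedSpace ℝ E]

theorem continuous_iteratedFDeriv_eval (n : ℕ) (y : E) :
    Continuous fun f : 𝓢(E, ℂ) => iteratedFDeriv ℝ n f y := by
  let L : 𝓢(E, ℂ) →L[ℝ] ContinuousMultilinearMap ℝ (fun _ : Fin n => E) ℂ :=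
    SchwartzMap.mkCLMtoNormedSpace (σ := RingHom.id ℝ) (fun f : 𝓢(E, ℂ) => iteratedFDeriv ℝ n f y)
      (fun f g => iteratedFDeriv_add_apply (f.smooth n).contDiffAt (g.smooth n).contDiffAt)
      (fun a f => iteratedFDeriv_const_smul_apply (f.smooth n).contDiffAt)
      ⟨{(0, n)}, 1, zero_le_one, fun f => by
        rw [one_mul, Finset.sup_singleton]
        exact norm_iteratedFDeriv_le_seminorm ℝ f n y⟩
  exact L.continuous

/-- The index set for the weighted derivatives of orders in `s`, evaluated at points of `E` and on
vectors of norm at most one. -/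
def WeightedDerivIndex (E : Type*) [NormedAddCommGroup E] (s : Finset (ℕ × ℕ)) : Type _ :=
  Σ i : s, E × (Fin i.1.2 → Metric.closedBall (0 : E) 1)

/-- With the discrete topology every bounded function is continuous, so the target of
`weightedDerivCLM` is the Banach space of all bounded functions on the index set. -/
instance (s : Finset (ℕ × ℕ)) : TopologicalSpace (WeightedDerivIndex E s) := ⊥

instance (s : Finset (ℕ × ℕ)) : DiscreteTopology (WeightedDerivIndex E s) := ⟨rfl⟩

/-- The weighted derivative `‖y‖ ^ k • D ^ n f y m` of `f` at an index `((k, n), y, m)`. -/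
def weightedDeriv {s : Finset (ℕ × ℕ)} (x : WeightedDerivIndex E s) (f : E → ℂ) : ℂ :=
  ‖x.2.1‖ ^ x.1.1.1 • iteratedFDeriv ℝ x.1.1.2 f x.2.1 fun j => x.2.2 j

theorem norm_weightedDeriv_le {s : Finset (ℕ × ℕ)} (x : WeightedDerivIndex E s) (f : 𝓢(E, ℂ)) :
    ‖weightedDeriv x f‖ ≤ SchwartzMap.seminorm ℝ x.1.1.1 x.1.1.2 f := by
  refine le_trans ?_ (le_seminorm ℝ x.1.1.1 x.1.1.2 f x.2.1)
  rw [weightedDeriv, norm_smul, norm_pow, norm_norm]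
  gcongr
  refine (ContinuousMultilinearMap.le_opNorm _ _).trans
    (mul_le_of_le_one_right (norm_nonneg _) (Finset.prod_le_one (fun _ _ => norm_nonneg _) ?_))
  intro j _
  exact mem_closedBall_zero_iff.1 (x.2.2 j).2

theorem seminorm_le_of_norm_weightedDeriv_le {s : Finset (ℕ × ℕ)} (f : 𝓢(E, ℂ)) {C : ℝ}
    (hC : 0 ≤ C) (h : ∀ x : WeightedDerivIndex E s, ‖weightedDeriv x f‖ ≤ C) {i : ℕ × ℕ}
    (hi : i ∈ s) : SchwartzMap.seminorm ℝ i.1 i.2 f ≤ C := by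
  refine seminorm_le_bound ℝ _ _ f hC fun y => ?_
  have h1 : ‖‖y‖ ^ i.1 • iteratedFDeriv ℝ i.2 f y‖ ≤ C := by
    refine ContinuousMultilinearMap.opNorm_le_bound hC fun m => ?_
    have hu : ∀ j, ‖m j‖⁻¹ • m j ∈ Metric.closedBall (0 : E) 1 := fun j => by
      rw [mem_closedBall_zero_iff, norm_smul, norm_inv, norm_norm]
      exact inv_mul_le_one
    have hm : m = fun j => ‖m j‖ • ‖m j‖⁻¹ • m j := by
      funext j
      rcases eq_or_ne (m j) 0 with h0 | h0
      · simp [h0]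
      · rw [smul_inv_smul₀ (norm_ne_zero_iff.2 h0)]
    have hx := h ⟨⟨i, hi⟩, y, fun j => ⟨_, hu j⟩⟩
    conv_lhs => rw [hm]
    rw [ContinuousMultilinearMap.map_smul_univ, norm_smul, norm_prod, mul_comm]
    simp only [norm_norm]
    gcongr
    exact hx
  rwa [norm_smul, norm_pow, norm_norm] at h1

/-- The weighted derivatives of orders in `s`, as a bounded function depending linearly and
continuously on the Schwartz function. -/
def weightedDerivCLM (s : Finset (ℕ × ℕ)) : 𝓢(E, ℂ) →L[ℝ] WeightedDerivIndex E s →ᵇ ℂ :=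
  SchwartzMap.mkCLMtoNormedSpace (σ := RingHom.id ℝ)
    (fun f : 𝓢(E, ℂ) => BoundedContinuousFunction.ofNormedAddCommGroupDiscrete
      (fun x => weightedDeriv x f) (∑ i ∈ s, SchwartzMap.seminorm ℝ i.1 i.2 f) fun x =>
        (norm_weightedDeriv_le x f).trans (Finset.single_le_sum
          (f := fun i : ℕ × ℕ => SchwartzMap.seminorm ℝ i.1 i.2 f)
          (fun i _ => apply_nonneg _ _) x.1.2))
    (fun f g => by
      ext x
      have h : ((f + g : 𝓢(E, ℂ)) : E → ℂ) = (f : E → ℂ) + g := rfl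
      show weightedDeriv x ((f + g : 𝓢(E, ℂ)) : E → ℂ) = weightedDeriv x f + weightedDeriv x g
      simp only [weightedDeriv]
      rw [h, iteratedFDeriv_add_apply (f.smooth _).contDiffAt (g.smooth _).contDiffAt,
        add_apply, smul_add])
    (fun a f => by
      ext x
      have h : ((a • f : 𝓢(E, ℂ)) : E → ℂ) = a • (f : E → ℂ) := rfl
      show weightedDeriv x ((a • f : 𝓢(E, ℂ)) : E → ℂ) = a • weightedDeriv x f
      simp only [weightedDeriv]
      rw [h, iteratedFDeriv_const_smul_apply (f.smooth _).contDiffAt,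
        smul_apply, smul_comm])
    ⟨s, 1, zero_le_one, fun f => by
      rw [one_mul, BoundedContinuousFunction.norm_le (apply_nonneg _ _)]
      exact fun x => (norm_weightedDeriv_le x f).trans
        (Seminorm.le_finset_sup_apply (p := schwartzSeminormFamily ℝ E ℂ) x.1.2)⟩

theorem norm_weightedDerivCLM_le (s : Finset (ℕ × ℕ)) (f : 𝓢(E, ℂ)) :
    ‖weightedDerivCLM s f‖ ≤ ∑ i ∈ s, SchwartzMap.seminorm ℝ i.1 i.2 f := by
  rw [BoundedContinuousFunction.norm_le (Finset.sum_nonneg fun i _ => apply_nonneg _ _)]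
  exact fun x => (norm_weightedDeriv_le x f).trans (Finset.single_le_sum
    (f := fun i : ℕ × ℕ => SchwartzMap.seminorm ℝ i.1 i.2 f) (fun i _ => apply_nonneg _ _) x.1.2)

theorem seminorm_le_norm_weightedDerivCLM {s : Finset (ℕ × ℕ)} (f : 𝓢(E, ℂ)) {i : ℕ × ℕ}
    (hi : i ∈ s) : SchwartzMap.seminorm ℝ i.1 i.2 f ≤ ‖weightedDerivCLM s f‖ :=
  seminorm_le_of_norm_weightedDeriv_le f (norm_nonneg _)
    (fun x => (weightedDerivCLM s f).norm_coe_le_norm x) hi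

/-- A linear functional that is bounded in terms of an injective linear map into a normed space
factors through it. -/
theorem exists_dual_comp_eq {S W : Type*} [AddCommGroup S] [Module ℝ S] [NormedAddCommGroup W]
    [NormedSpace ℝ W] (J : S →ₗ[ℝ] W) (hJ : Function.Injective J) (U : S →ₗ[ℝ] ℝ) (C : ℝ)
    (h : ∀ f, ‖U f‖ ≤ C * ‖J f‖) : ∃ Λ : W →L[ℝ] ℝ, ∀ f, U f = Λ (J f) := by
  let e := LinearEquiv.ofInjective J hJ
  have hbound : ∀ v, ‖(U ∘ₗ e.symm.toLinearMap) v‖ ≤ C * ‖v‖ := by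
    intro v
    obtain ⟨f, rfl⟩ := e.surjective v
    rw [LinearMap.comp_apply, LinearEquiv.coe_coe, e.symm_apply_apply]
    exact h f
  obtain ⟨Λ, hΛ, -⟩ := exists_extension_norm_eq (𝕜 := ℝ) _
    (LinearMap.mkContinuous _ _ hbound)
  refine ⟨Λ, fun f => ?_⟩
  refine Eq.trans ?_ (hΛ (e f)).symm
  rw [LinearMap.mkContinuous_apply, LinearMap.comp_apply, LinearEquiv.coe_coe, e.symm_apply_apply]

/-- Real functionals on the Schwartz space factor through finitely many weighted derivatives. -/
theorem exists_dual_weightedDeriv (U : 𝓢(E, ℂ) →L[ℝ] ℝ) :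
    ∃ (s : Finset (ℕ × ℕ)) (Λ : (WeightedDerivIndex E s →ᵇ ℂ) →L[ℝ] ℝ),
      ∀ f, U f = Λ (weightedDerivCLM s f) := by
  have hq : Continuous ((normSeminorm ℝ ℝ).comp (U : 𝓢(E, ℂ) →ₗ[ℝ] ℝ)) :=
    continuous_norm.comp U.continuous
  obtain ⟨s₀, C, hC, hs₀⟩ := exists_le_sum_schwartz_seminorm hq
  -- The index `(0, 0)` controls the supremum of `f` itself and makes `J` injective.
  set s := insert (0, 0) s₀ with hs
  let J : 𝓢(E, ℂ) →ₗ[ℝ] WeightedDerivIndex E s →ᵇ ℂ := (weightedDerivCLM s).toLinearMap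
  have hJ : Function.Injective J := by
    refine (injective_iff_map_eq_zero J).2 fun f hf => ?_
    have h1 := seminorm_le_norm_weightedDerivCLM f (Finset.mem_insert_self (0, 0) s₀)
    have h2 : ‖weightedDerivCLM s f‖ = 0 := norm_eq_zero.2 hf
    rw [← hs, h2] at h1
    ext y
    exact norm_le_zero_iff.1 ((norm_le_seminorm ℝ f y).trans h1)
  obtain ⟨Λ, hΛ⟩ := exists_dual_comp_eq J hJ U.toLinearMap (C * s₀.card) fun f => by
    calc ‖U f‖ ≤ C * ∑ i ∈ s₀, SchwartzMap.seminorm ℝ i.1 i.2 f := hs₀ f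
      _ ≤ C * ∑ i ∈ s₀, ‖weightedDerivCLM s f‖ := by
          gcongr with i hi
          exact seminorm_le_norm_weightedDerivCLM f (Finset.mem_insert_of_mem hi)
      _ = _ := by
          rw [Finset.sum_const, nsmul_eq_mul, mul_assoc]
          rfl
  exact ⟨s, Λ, hΛ⟩

variable {Z : Type*} [TopologicalSpace Z] [SecondCountableTopology Z] [MeasurableSpace Z]
  [OpensMeasurableSpace Z] {μ : Measure Z} {F : Z → 𝓢(E, ℂ)}

theorem integrable_iteratedFDeriv_eval (hF : Continuous F)
    (hint : ∀ k n, Integrable (fun z => SchwartzMap.seminorm ℝ k n (F z)) μ) (n : ℕ) (y : E) :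
    Integrable (fun z => iteratedFDeriv ℝ n (F z) y) μ := by
  refine (hint 0 n).mono' ((continuous_iteratedFDeriv_eval n y).comp hF).aestronglyMeasurable
    (.of_forall fun z => ?_)
  exact norm_iteratedFDeriv_le_seminorm ℝ _ _ _

theorem hasFDerivAt_integral_iteratedFDeriv (hF : Continuous F)
    (hint : ∀ k n, Integrable (fun z => SchwartzMap.seminorm ℝ k n (F z)) μ) (n : ℕ) (y : E) :
    HasFDerivAt (fun y => ∫ z, iteratedFDeriv ℝ n (F z) y ∂μ)
      (∫ z, fderiv ℝ (iteratedFDeriv ℝ n (F z)) y ∂μ) y := by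
  refine hasFDerivAt_integral_of_dominated_of_fderiv_le (s := Set.univ) Filter.univ_mem
    (F' := fun y z => fderiv ℝ (iteratedFDeriv ℝ n (F z)) y)
    (bound := fun z => SchwartzMap.seminorm ℝ 0 (n + 1) (F z))
    (.of_forall fun y => (integrable_iteratedFDeriv_eval hF hint n y).aestronglyMeasurable)
    (integrable_iteratedFDeriv_eval hF hint n y) ?_ ?_ (hint 0 (n + 1)) ?_
  · have h : (fun z => fderiv ℝ (iteratedFDeriv ℝ n (F z)) y) = fun z =>
        continuousMultilinearCurryLeftEquiv ℝ (fun _ : Fin (n + 1) => E) ℂ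
          (iteratedFDeriv ℝ (n + 1) (F z) y) := by
      funext z
      rw [fderiv_iteratedFDeriv]
      rfl
    rw [h]
    exact ((LinearIsometryEquiv.continuous _).comp
      ((continuous_iteratedFDeriv_eval (n + 1) y).comp hF)).aestronglyMeasurable
  · refine .of_forall fun z x _ => ?_
    rw [norm_fderiv_iteratedFDeriv]
    exact norm_iteratedFDeriv_le_seminorm ℝ _ _ _
  · refine .of_forall fun z x _ => DifferentiableAt.hasFDerivAt ?_
    exact ((F z).smooth ⊤).differentiable_iteratedFDeriv (mod_cast WithTop.coe_lt_top n) x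

theorem iteratedFDeriv_integral_schwartz (hF : Continuous F)
    (hint : ∀ k n, Integrable (fun z => SchwartzMap.seminorm ℝ k n (F z)) μ) (n : ℕ) :
    iteratedFDeriv ℝ n (fun y => ∫ z, F z y ∂μ) =
      fun y => ∫ z, iteratedFDeriv ℝ n (F z) y ∂μ := by
  induction n with
  | zero =>
    funext y
    simp only [iteratedFDeriv_zero_eq_comp, Function.comp_apply]
    exact ((continuousMultilinearCurryFin0 ℝ E ℂ).symm.toContinuousLinearEquiv.integral_comp_comm
      (fun z => F z y)).symm
  | succ n ih =>
    funext y
    simp only [iteratedFDeriv_succ_eq_comp_left, Function.comp_apply]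
    rw [ih, (hasFDerivAt_integral_iteratedFDeriv hF hint n y).fderiv]
    exact ((continuousMultilinearCurryLeftEquiv ℝ
      (fun _ : Fin (n + 1) => E) ℂ).symm.toContinuousLinearEquiv.integral_comp_comm (𝕜 := ℝ)
      (fun z => fderiv ℝ (iteratedFDeriv ℝ n (F z)) y)).symm

/-- Integrals of continuous families of Schwartz functions, converging absolutely for all seminorms,
exist in the Schwartz space and commute with continuous real-linear functionals. -/
theorem exists_schwartz_integral (hF : Continuous F)
    (hint : ∀ k n, Integrable (fun z => SchwartzMap.seminorm ℝ k n (F z)) μ) :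
    ∃ φ : 𝓢(E, ℂ), (∀ y, φ y = ∫ z, F z y ∂μ) ∧
      ∀ U : 𝓢(E, ℂ) →L[ℝ] ℂ, Integrable (fun z => U (F z)) μ ∧ U φ = ∫ z, U (F z) ∂μ := by
  let φ : 𝓢(E, ℂ) :=
    { toFun := fun y => ∫ z, F z y ∂μ
      smooth' := by
        refine contDiff_of_differentiable_iteratedFDeriv fun n _ => ?_
        rw [iteratedFDeriv_integral_schwartz hF hint]
        exact fun y => (hasFDerivAt_integral_iteratedFDeriv hF hint n y).differentiableAt
      decay' := fun k n => by
        refine ⟨∫ z, SchwartzMap.seminorm ℝ k n (F z) ∂μ, fun y => ?_⟩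
        rw [iteratedFDeriv_integral_schwartz hF hint]
        calc ‖y‖ ^ k * ‖∫ z, iteratedFDeriv ℝ n (F z) y ∂μ‖
            ≤ ‖y‖ ^ k * ∫ z, ‖iteratedFDeriv ℝ n (F z) y‖ ∂μ := by
              gcongr
              exact norm_integral_le_integral_norm _
          _ = ∫ z, ‖y‖ ^ k * ‖iteratedFDeriv ℝ n (F z) y‖ ∂μ := by
              rw [integral_const_mul]
          _ ≤ _ := by
              refine integral_mono ?_ (hint k n) fun z => le_seminorm ℝ k n (F z) y
              exact (integrable_iteratedFDeriv_eval hF hint n y).norm.const_mul _ }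
  have hφ : ∀ y, φ y = ∫ z, F z y ∂μ := fun y => rfl
  have hφn : ∀ n y, iteratedFDeriv ℝ n φ y = ∫ z, iteratedFDeriv ℝ n (F z) y ∂μ :=
    fun n y => congrFun (iteratedFDeriv_integral_schwartz hF hint n) y
  have hsum : ∀ s : Finset (ℕ × ℕ),
      Integrable (fun z => ∑ i ∈ s, SchwartzMap.seminorm ℝ i.1 i.2 (F z)) μ :=
    fun s => integrable_finsetSum _ fun i _ => hint i.1 i.2
  -- By Hahn–Banach, `U` factors through a Banach space, where bounded functionals commute with the
  -- Bochner integral; the integral there is identified with the image of `φ` coordinate by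
  -- coordinate.
  have hreal : ∀ U : 𝓢(E, ℂ) →L[ℝ] ℝ, U φ = ∫ z, U (F z) ∂μ := by
    intro U
    obtain ⟨s, Λ, hΛ⟩ := exists_dual_weightedDeriv U
    have hJi : Integrable (fun z => weightedDerivCLM s (F z)) μ :=
      (hsum s).mono' ((weightedDerivCLM s).continuous.comp hF).aestronglyMeasurable
        (.of_forall fun z => norm_weightedDerivCLM_le s (F z))
    have hJφ : weightedDerivCLM s φ = ∫ z, weightedDerivCLM s (F z) ∂μ := by
      ext x
      have h := (BoundedContinuousFunction.evalCLM ℝ x (β := ℂ)).integral_comp_comm hJi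
      refine Eq.trans ?_ h
      show weightedDeriv x φ = ∫ z, weightedDeriv x (F z) ∂μ
      simp only [weightedDeriv]
      rw [hφn, integral_smul]
      congr 1
      exact ((ContinuousMultilinearMap.apply ℝ (fun _ => E) ℂ _).integral_comp_comm
        (integrable_iteratedFDeriv_eval hF hint _ _)).symm
    rw [hΛ, hJφ, ← Λ.integral_comp_comm hJi]
    simp_rw [hΛ]
  refine ⟨φ, hφ, fun U => ?_⟩
  have hq : Continuous ((normSeminorm ℝ ℂ).comp (U : 𝓢(E, ℂ) →ₗ[ℝ] ℂ)) :=
    continuous_norm.comp U.continuous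
  obtain ⟨s, C, hC, hs⟩ := exists_le_sum_schwartz_seminorm hq
  have hUi : Integrable (fun z => U (F z)) μ :=
    ((hsum s).const_mul C).mono' (U.continuous.comp hF).aestronglyMeasurable
      (.of_forall fun z => hs (F z))
  refine ⟨hUi, ?_⟩
  apply Complex.ext
  · have h := hreal (Complex.reCLM ∘L U)
    have h2 := Complex.reCLM.integral_comp_comm hUi
    exact h.trans h2
  · have h := hreal (Complex.imCLM ∘L U)
    have h2 := Complex.imCLM.integral_comp_comm hUi
    exact h.trans h2

end WeakIntegral

/-! ### The short-time Fourier transform: decay, inversion, duality, covariance. -/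

section ShortTime

variable {V : Type*} [NormedAddCommGroup V] [InnerProductSpace ℝ V]

/-- Complex conjugation of Schwartz functions as a continuous real-linear map. -/
def conjSchwartzCLM : 𝓢(V, ℂ) →L[ℝ] 𝓢(V, ℂ) :=
  SchwartzMap.postcompCLM (𝕜 := ℝ) (Complex.conjCLE : ℂ →L[ℝ] ℂ)

/-- The functional `φ ↦ ⟨u, φ⟩`, which is continuous and real-linear. -/
def sesqPairingCLM (u : 𝓢'(V, ℂ)) : 𝓢(V, ℂ) →L[ℝ] ℂ where
  toFun φ := sesqPairing u φ
  map_add' φ ψ := by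
    show u (conjSchwartzCLM (φ + ψ)) = _
    rw [map_add, map_add]
    rfl
  map_smul' c φ := by
    show u (conjSchwartzCLM (c • φ)) = c • u (conjSchwartzCLM φ)
    rw [map_smul, ← Complex.coe_smul c (conjSchwartzCLM φ), map_smul, Complex.coe_smul]
  cont := (map_continuous u).comp conjSchwartzCLM.continuous

theorem sesqPairingCLM_apply (u : 𝓢'(V, ℂ)) (φ : 𝓢(V, ℂ)) :
    sesqPairingCLM u φ = sesqPairing u φ := rfl

theorem continuous_sesqPairing (u : 𝓢'(V, ℂ)) : Continuous (sesqPairing u) :=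
  (sesqPairingCLM u).continuous

theorem sesqPairing_smul (u : 𝓢'(V, ℂ)) (c : ℂ) (φ : 𝓢(V, ℂ)) :
    sesqPairing u (c • φ) = starRingEnd ℂ c * sesqPairing u φ := by
  have h : conjSchwartz (c • φ) = starRingEnd ℂ c • conjSchwartz φ := by
    ext y
    simp [conjSchwartz_apply]
  rw [sesqPairing, h, map_smul, smul_eq_mul]
  rfl

/-- The product of `f` with the conjugate of the translate by `x` of the window `g`. -/
def windowed (g : 𝓢(V, ℂ)) (x : V) (f : 𝓢(V, ℂ)) : 𝓢(V, ℂ) :=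
  smulLeftCLM ℂ (conjSchwartz (compSubConstCLM ℂ x g)) f

theorem windowed_apply (g : 𝓢(V, ℂ)) (x : V) (f : 𝓢(V, ℂ)) (y : V) :
    windowed g x f y = starRingEnd ℂ (g (y - x)) * f y := by
  rw [windowed, smulLeftCLM_apply_apply (SchwartzMap.hasTemperateGrowth _)]
  rfl

theorem iteratedFDeriv_conjSchwartz_compSubConstCLM (g : 𝓢(V, ℂ)) (x y : V) (n : ℕ) :
    iteratedFDeriv ℝ n (conjSchwartz (compSubConstCLM ℂ x g)) y =
      iteratedFDeriv ℝ n (conjSchwartz g) (y - x) := by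
  have h : conjSchwartz (compSubConstCLM ℂ x g) = compSubConstCLM ℂ x (conjSchwartz g) := rfl
  rw [h, iteratedFDeriv_compSubConstCLM]

/-- The windowed functions decay rapidly in the position of the window. -/
theorem exists_seminorm_windowed_le (g : 𝓢(V, ℂ)) (N : ℕ) {p : Seminorm ℝ 𝓢(V, ℂ)}
    (hp : Continuous p) :
    ∃ q : Seminorm ℝ 𝓢(V, ℂ), Continuous q ∧ ∀ x f,
      (1 + ‖x‖) ^ N * p (windowed g x f) ≤ q f := by
  refine exists_seminorm_comp_le (fun x : V => by positivity) (fun k n => ?_) hp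
  choose Q hQ hQ' using fun k n => exists_seminorm_one_add_pow_mul_le (E := V) k n
  have hQ0 : ∀ k n f, 0 ≤ Q k n f := fun k n f => apply_nonneg _ _
  set C : ℝ := ∑ i ∈ Finset.range (n + 1), (n.choose i : ℝ) * Q N i (conjSchwartz g) with hCdef
  have hC : 0 ≤ C := Finset.sum_nonneg fun i _ => mul_nonneg (by positivity) (hQ0 _ _ _)
  obtain ⟨q, hq, hq'⟩ := exists_seminorm_eq_mul_sum (Finset.range (n + 1))
    (fun i => hQ (k + N) (n - i)) hC
  refine ⟨q, hq, fun x f => ?_⟩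
  rw [hq', mul_comm, ← le_div_iff₀ (by positivity)]
  refine seminorm_le_bound ℝ k n _ (div_nonneg (mul_nonneg hC
    (Finset.sum_nonneg fun i _ => hQ0 _ _ _)) (by positivity)) fun y => ?_
  rw [le_div_iff₀ (by positivity)]
  have hfun : (windowed g x f : V → ℂ) =
      fun y => conjSchwartz (compSubConstCLM ℂ x g) y * f y := by
    funext y
    rw [windowed_apply]
    rfl
  have hmul := norm_iteratedFDeriv_mul_le (𝕜 := ℝ) (N := ∞) (n := n)
    ((conjSchwartz (compSubConstCLM ℂ x g)).smooth ⊤) (f.smooth ⊤) y (mod_cast le_top)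
  -- Decay in `x` is shared between the window, which decays in `y - x`, and `f`, which decays in
  -- `y`.
  have hx : 1 + ‖x‖ ≤ (1 + ‖y‖) * (1 + ‖y - x‖) := by
    rw [norm_sub_rev]
    exact one_add_norm_le_mul_one_add_norm_sub x y
  rw [hfun]
  calc ‖y‖ ^ k * ‖iteratedFDeriv ℝ n
        (fun y => conjSchwartz (compSubConstCLM ℂ x g) y * f y) y‖ * (1 + ‖x‖) ^ N
      ≤ (1 + ‖y‖) ^ k * (∑ i ∈ Finset.range (n + 1), (n.choose i : ℝ) *
          ‖iteratedFDeriv ℝ i (conjSchwartz (compSubConstCLM ℂ x g)) y‖ *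
          ‖iteratedFDeriv ℝ (n - i) f y‖) * ((1 + ‖y‖) * (1 + ‖y - x‖)) ^ N := by
        gcongr
        linarith
    _ = ∑ i ∈ Finset.range (n + 1), (n.choose i : ℝ) *
          ((1 + ‖y - x‖) ^ N * ‖iteratedFDeriv ℝ i (conjSchwartz g) (y - x)‖) *
          ((1 + ‖y‖) ^ (k + N) * ‖iteratedFDeriv ℝ (n - i) f y‖) := by
        rw [Finset.mul_sum, Finset.sum_mul]
        refine Finset.sum_congr rfl fun i _ => ?_
        rw [iteratedFDeriv_conjSchwartz_compSubConstCLM, mul_pow, pow_add]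
        ring
    _ ≤ ∑ i ∈ Finset.range (n + 1), C * Q (k + N) (n - i) f := by
        refine Finset.sum_le_sum fun i hi => ?_
        gcongr
        · refine le_trans ?_ (Finset.single_le_sum
            (f := fun i => (n.choose i : ℝ) * Q N i (conjSchwartz g))
            (fun i _ => mul_nonneg (by positivity) (hQ0 _ _ _)) hi)
          gcongr
          exact hQ' _ _ _ _
        · exact hQ' _ _ _ _
    _ = C * ∑ i ∈ Finset.range (n + 1), Q (k + N) (n - i) f := by rw [Finset.mul_sum]

variable [FiniteDimensional ℝ V] [MeasurableSpace V] [BorelSpace V]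

theorem continuous_stft (g : 𝓢(V, ℂ)) (u : 𝓢'(V, ℂ)) : Continuous (stft g u) :=
  (continuous_sesqPairing u).comp (continuous_timeFreqShift g)

theorem stft_coe (g f : 𝓢(V, ℂ)) (z : V × V) :
    stft g (f : 𝓢'(V, ℂ)) z = ∫ y, starRingEnd ℂ (timeFreqShift z.1 z.2 g y) * f y := by
  rw [stft, sesqPairing, SchwartzMap.coe_apply]
  rfl

/-- At a fixed position this is the Fourier transform of a Schwartz function: decay in frequency
comes from here, decay in position from `exists_seminorm_windowed_le`. -/
theorem stft_coe_eq_fourier (g f : 𝓢(V, ℂ)) (x ξ : V) :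
    stft g (f : 𝓢'(V, ℂ)) (x, ξ) = 𝓕 (windowed g x f) ξ := by
  rw [stft_coe, fourier_coe, Real.fourier_eq']
  congr 1 with y
  rw [timeFreqShift_apply, windowed_apply, map_mul, ← Complex.exp_conj, smul_eq_mul, mul_assoc]
  congr 2
  simp only [map_mul, Complex.conj_ofReal, Complex.conj_I, map_ofNat]
  push_cast
  ring

/-- The short-time Fourier transform of a Schwartz function decays rapidly. -/
theorem exists_seminorm_stft_coe_le (g : 𝓢(V, ℂ)) (N : ℕ) :
    ∃ q : Seminorm ℝ 𝓢(V, ℂ), Continuous q ∧ ∀ (f : 𝓢(V, ℂ)) (z : V × V),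
      ((1 + ‖z.1‖) ^ N * (1 + ‖z.2‖) ^ N) * ‖stft g (f : 𝓢'(V, ℂ)) z‖ ≤ q f := by
  obtain ⟨p, hp, hp'⟩ := exists_seminorm_one_add_pow_mul_le (E := V) N 0
  let F : 𝓢(V, ℂ) →L[ℝ] 𝓢(V, ℂ) := FourierTransform.fourierCLM ℝ 𝓢(V, ℂ)
  have hp2 : Continuous (p.comp (F : 𝓢(V, ℂ) →ₗ[ℝ] 𝓢(V, ℂ))) := hp.comp F.continuous
  obtain ⟨q, hq, hq'⟩ := exists_seminorm_windowed_le g N hp2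
  refine ⟨q, hq, fun f z => ?_⟩
  refine le_trans ?_ (hq' z.1 f)
  rw [mul_assoc]
  gcongr
  have h := hp' (𝓕 (windowed g z.1 f)) z.2
  rw [norm_iteratedFDeriv_zero] at h
  rw [show z = (z.1, z.2) from rfl, stft_coe_eq_fourier]
  exact h

/-- An integrable weight on phase space. -/
def phaseSpaceWeight (z : V × V) : ℝ :=
  ((1 + ‖z.1‖) ^ (Module.finrank ℝ V + 1) * (1 + ‖z.2‖) ^ (Module.finrank ℝ V + 1))⁻¹

omit [FiniteDimensional ℝ V] [MeasurableSpace V] [BorelSpace V] in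
theorem phaseSpaceWeight_nonneg (z : V × V) : 0 ≤ phaseSpaceWeight z := by
  unfold phaseSpaceWeight
  positivity

omit [FiniteDimensional ℝ V] [MeasurableSpace V] [BorelSpace V] in
theorem continuous_phaseSpaceWeight : Continuous (phaseSpaceWeight : V × V → ℝ) := by
  unfold phaseSpaceWeight
  refine Continuous.inv₀ (by fun_prop) fun z => ?_
  positivity

theorem integrable_one_add_norm_pow_inv :
    Integrable fun x : V => ((1 + ‖x‖) ^ (Module.finrank ℝ V + 1))⁻¹ := by
  have h := integrable_one_add_norm (E := V) (μ := volume) (r := (Module.finrank ℝ V + 1 : ℕ))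
    (by push_cast; linarith)
  convert h using 2 with x
  rw [Real.rpow_neg (by positivity), Real.rpow_natCast]

theorem integrable_phaseSpaceWeight : Integrable (phaseSpaceWeight : V × V → ℝ) := by
  have h := (integrable_one_add_norm_pow_inv (V := V)).mul_prod
    (integrable_one_add_norm_pow_inv (V := V))
  refine h.congr (.of_forall fun z => ?_)
  simp only [phaseSpaceWeight]
  rw [mul_inv]

/-- The factor of order `m` absorbs the polynomial growth of time-frequency shifts in a given
seminorm, leaving an integrable bound. -/
theorem exists_seminorm_stft_coe_le_weight (g : 𝓢(V, ℂ)) (m : ℕ) :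
    ∃ q : Seminorm ℝ 𝓢(V, ℂ), Continuous q ∧ ∀ (f : 𝓢(V, ℂ)) (z : V × V),
      ‖stft g (f : 𝓢'(V, ℂ)) z‖ * ((1 + ‖z.1‖) ^ m * (1 + ‖z.2‖) ^ m) ≤
        q f * phaseSpaceWeight z := by
  obtain ⟨q, hq, hq'⟩ := exists_seminorm_stft_coe_le g (m + (Module.finrank ℝ V + 1))
  refine ⟨q, hq, fun f z => ?_⟩
  rw [phaseSpaceWeight, ← div_eq_mul_inv, le_div_iff₀ (by positivity)]
  refine le_of_eq_of_le ?_ (hq' f z)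
  rw [pow_add, pow_add]
  ring

theorem exists_seminorm_stft_coe_le_weight' (g : 𝓢(V, ℂ)) :
    ∃ q : Seminorm ℝ 𝓢(V, ℂ), Continuous q ∧ ∀ (f : 𝓢(V, ℂ)) (z : V × V),
      ‖stft g (f : 𝓢'(V, ℂ)) z‖ ≤ q f * phaseSpaceWeight z := by
  obtain ⟨q, hq, hq'⟩ := exists_seminorm_stft_coe_le_weight g 0
  exact ⟨q, hq, fun f z => by simpa using hq' f z⟩

/-- The squared `L²` norm of a Schwartz function. -/
def energy (g : 𝓢(V, ℂ)) : ℝ := ∫ y, ‖g y‖ ^ 2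

theorem energy_pos {g : 𝓢(V, ℂ)} (hg : g ≠ 0) : 0 < energy g := by
  have hi : Integrable fun y => ‖g y‖ ^ 2 := (g.memLp 2).integrable_norm_pow (by norm_num)
  refine (integral_pos_iff_support_of_nonneg (fun y => by positivity) hi).2 ?_
  refine IsOpen.measure_pos _ (g.continuous.norm.pow 2).isOpen_support ?_
  obtain ⟨y, hy⟩ : ∃ y, g y ≠ 0 := by
    by_contra! h
    exact hg (SchwartzMap.ext h)
  exact ⟨y, by simpa using hy⟩

omit [FiniteDimensional ℝ V] [MeasurableSpace V] [BorelSpace V] in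
theorem seminorm_smul_complex (k n : ℕ) (c : ℂ) (f : 𝓢(V, ℂ)) :
    SchwartzMap.seminorm ℝ k n (c • f) = ‖c‖ * SchwartzMap.seminorm ℝ k n f :=
  map_smul_eq_mul (SchwartzMap.seminorm ℂ k n) c f

theorem continuous_stft_smul_timeFreqShift (g : 𝓢(V, ℂ)) (u : 𝓢'(V, ℂ)) :
    Continuous fun z : V × V => stft g u z • timeFreqShift z.1 z.2 g :=
  (continuous_stft g u).smul (continuous_timeFreqShift g)

theorem integrable_seminorm_stft_smul_timeFreqShift (g f : 𝓢(V, ℂ)) (k n : ℕ) :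
    Integrable fun z : V × V => SchwartzMap.seminorm ℝ k n
      (stft g (f : 𝓢'(V, ℂ)) z • timeFreqShift z.1 z.2 g) := by
  obtain ⟨m, C, hC, hm⟩ := exists_seminorm_timeFreqShift_le g
    (continuous_schwartz_seminorm (E := V) k n)
  obtain ⟨q, hq, hq'⟩ := exists_seminorm_stft_coe_le_weight g m
  refine ((integrable_phaseSpaceWeight (V := V)).const_mul (C * q f)).mono'
    ((continuous_schwartz_seminorm k n).comp
      (continuous_stft_smul_timeFreqShift g (f : 𝓢'(V, ℂ)))).aestronglyMeasurable
    (.of_forall fun z => ?_)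
  rw [Real.norm_of_nonneg (apply_nonneg _ _), seminorm_smul_complex]
  calc ‖stft g (f : 𝓢'(V, ℂ)) z‖ * SchwartzMap.seminorm ℝ k n (timeFreqShift z.1 z.2 g)
      ≤ ‖stft g (f : 𝓢'(V, ℂ)) z‖ * (C * ((1 + ‖z.1‖) ^ m * (1 + ‖z.2‖) ^ m)) := by
        gcongr
        exact hm _ _
    _ = C * (‖stft g (f : 𝓢'(V, ℂ)) z‖ * ((1 + ‖z.1‖) ^ m * (1 + ‖z.2‖) ^ m)) := by ring
    _ ≤ C * (q f * phaseSpaceWeight z) := mul_le_mul_of_nonneg_left (hq' f z) hC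
    _ = C * q f * phaseSpaceWeight z := by ring

/-- Pointwise inversion formula for the short-time Fourier transform of Schwartz functions. -/
theorem integral_stft_mul_timeFreqShift (g f : 𝓢(V, ℂ)) (y : V) :
    ∫ z : V × V, stft g (f : 𝓢'(V, ℂ)) z * timeFreqShift z.1 z.2 g y = energy g * f y := by
  have hi : Integrable fun z : V × V => stft g (f : 𝓢'(V, ℂ)) z * timeFreqShift z.1 z.2 g y := by
    refine (integrable_seminorm_stft_smul_timeFreqShift g f 0 0).mono' ?_
      (.of_forall fun z => norm_le_seminorm ℝ
        (stft g (f : 𝓢'(V, ℂ)) z • timeFreqShift z.1 z.2 g) y)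
    refine ((continuous_stft g _).mul ?_).aestronglyMeasurable
    have h := (toBoundedContinuousFunctionCLM ℂ V ℂ).continuous.comp (continuous_timeFreqShift g)
    exact (BoundedContinuousFunction.evalCLM ℂ y).continuous.comp h
  rw [Measure.volume_eq_prod] at hi ⊢
  rw [integral_prod _ hi]
  -- The frequency integral is Fourier inversion for `windowed g x f`; integrating the resulting `‖g
  -- (y - x)‖ ^ 2` over `x` then gives the energy.
  have hinner : ∀ x : V, ∫ ξ : V, stft g (f : 𝓢'(V, ℂ)) (x, ξ) * timeFreqShift x ξ g y =
      ((‖g (y - x)‖ ^ 2 : ℝ) : ℂ) * f y := by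
    intro x
    have h1 : 𝓕⁻ (𝓕 (windowed g x f)) y = windowed g x f y := by
      rw [FourierTransform.fourierInv_fourier_eq]
    rw [fourierInv_coe, Real.fourierInv_eq'] at h1
    rw [windowed_apply] at h1
    calc ∫ ξ : V, stft g (f : 𝓢'(V, ℂ)) (x, ξ) * timeFreqShift x ξ g y
        = ∫ ξ : V, (Complex.exp (↑(2 * Real.pi * inner ℝ ξ y) * Complex.I) •
            (𝓕 (windowed g x f)) ξ) * g (y - x) := by
          congr 1 with ξ
          rw [stft_coe_eq_fourier, timeFreqShift_apply, smul_eq_mul, real_inner_comm]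
          have h2 : (2 * Real.pi * Complex.I * (inner ℝ ξ y : ℝ) : ℂ) =
            (2 * Real.pi * inner ℝ ξ y : ℝ) * Complex.I := by push_cast; ring
          rw [h2]
          ring
      _ = starRingEnd ℂ (g (y - x)) * f y * g (y - x) := by
          rw [integral_mul_const, h1]
      _ = _ := by
          rw [mul_right_comm, ← Complex.normSq_eq_conj_mul_self, Complex.normSq_eq_norm_sq]
  simp only [hinner]
  rw [integral_mul_const, integral_complex_ofReal]
  congr 2
  exact integral_sub_left_eq_self (fun x => ‖g x‖ ^ 2) volume y

/-- Reconstruction of real-linear functionals from their values on time-frequency shifts. -/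
theorem integral_apply_stft_smul_timeFreqShift (g f : 𝓢(V, ℂ)) (U : 𝓢(V, ℂ) →L[ℝ] ℂ) :
    Integrable (fun z : V × V =>
        U (stft g (f : 𝓢'(V, ℂ)) z • timeFreqShift z.1 z.2 g)) ∧
      ∫ z : V × V, U (stft g (f : 𝓢'(V, ℂ)) z • timeFreqShift z.1 z.2 g) = energy g * U f := by
  obtain ⟨φ, hφ, hU⟩ := exists_schwartz_integral (μ := (volume : Measure (V × V)))
    (continuous_stft_smul_timeFreqShift g (f : 𝓢'(V, ℂ)))
    (integrable_seminorm_stft_smul_timeFreqShift g f)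
  -- The Schwartz-valued integral is determined by its point values, which the pointwise inversion
  -- formula computes.
  have h : φ = energy g • f := by
    ext y
    rw [hφ, smul_apply, Complex.real_smul]
    exact integral_stft_mul_timeFreqShift g f y
  refine ⟨(hU U).1, ?_⟩
  rw [← (hU U).2, h, map_smul, Complex.real_smul]

/-- The duality formula `⟨u, φ⟩ = ‖g‖⁻² ∫ V_g u conj (V_g φ)`. -/
theorem integral_stft_mul_conj_stft (g : 𝓢(V, ℂ)) (u : 𝓢'(V, ℂ)) (φ : 𝓢(V, ℂ)) :
    Integrable (fun z => starRingEnd ℂ (stft g (φ : 𝓢'(V, ℂ)) z) * stft g u z) ∧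
      ∫ z, starRingEnd ℂ (stft g (φ : 𝓢'(V, ℂ)) z) * stft g u z =
        energy g * sesqPairing u φ := by
  have h := integral_apply_stft_smul_timeFreqShift g φ (sesqPairingCLM u)
  simp only [sesqPairingCLM_apply, sesqPairing_smul] at h
  exact h

/-- With `φ` a time-frequency shift of another window, covariance turns the right-hand side into a
convolution: this is the change of window estimate. -/
theorem ofReal_energy_mul_enorm_sesqPairing_le (g : 𝓢(V, ℂ)) (u : 𝓢'(V, ℂ)) (φ : 𝓢(V, ℂ)) :
    ENNReal.ofReal (energy g) * ‖sesqPairing u φ‖ₑ ≤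
      ∫⁻ z, ‖stft g u z‖ₑ * ‖stft g (φ : 𝓢'(V, ℂ)) z‖ₑ := by
  have h := (integral_stft_mul_conj_stft g u φ).2
  have h1 : 0 ≤ energy g := integral_nonneg fun y => by positivity
  have h2 : ENNReal.ofReal (energy g) * ‖sesqPairing u φ‖ₑ =
      ‖(energy g : ℂ) * sesqPairing u φ‖ₑ := by
    rw [enorm_mul]
    congr 1
    rw [← ofReal_norm, Complex.norm_real, Real.norm_of_nonneg h1]
  rw [h2, ← h]
  refine (enorm_integral_le_lintegral_enorm _).trans_eq ?_
  congr 1 with z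
  rw [enorm_mul, mul_comm]
  congr 1
  rw [← ofReal_norm, RCLike.norm_conj, ofReal_norm]

/-- Covariance of the short-time Fourier transform. -/
theorem norm_stft_timeFreqShift (γ ψ : 𝓢(V, ℂ)) (x ξ : V) (w : V × V) :
    ‖stft γ (timeFreqShift x ξ ψ : 𝓢'(V, ℂ)) w‖ =
      ‖stft γ (ψ : 𝓢'(V, ℂ)) (w - (x, ξ))‖ := by
  have h : stft γ (timeFreqShift x ξ ψ : 𝓢'(V, ℂ)) w =
      Complex.exp (2 * Real.pi * Complex.I * (inner ℝ x (ξ - w.2) : ℝ)) *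
        stft γ (ψ : 𝓢'(V, ℂ)) (w - (x, ξ)) := by
    rw [stft_coe, stft_coe, ← integral_const_mul, ← integral_add_right_eq_self _ x]
    congr 1 with y
    simp only [timeFreqShift_apply, Prod.fst_sub, Prod.snd_sub, map_mul, ← Complex.exp_conj,
      add_sub_cancel_right, Complex.conj_ofReal, Complex.conj_I, map_ofNat]
    rw [show y + x - w.1 = y - (w.1 - x) by abel]
    rw [mul_mul_mul_comm, ← Complex.exp_add, ← mul_assoc, ← mul_assoc, ← mul_assoc,
      ← Complex.exp_add]
    congr 3
    simp only [inner_add_left, inner_sub_right]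
    push_cast
    ring
  rw [h, norm_mul, norm_cexp_two_pi, one_mul]

end ShortTime

/-! ### Density of the Schwartz space in `M¹`. -/

section ModulationSpaces

variable {V : Type*} [NormedAddCommGroup V] [InnerProductSpace ℝ V]
  [FiniteDimensional ℝ V] [MeasurableSpace V] [BorelSpace V]

instance : (volume : Measure (V × V)).IsAddHaarMeasure :=
  inferInstanceAs ((volume : Measure V).prod (volume : Measure V)).IsAddHaarMeasure

theorem modNorm_one (g : 𝓢(V, ℂ)) (u : 𝓢'(V, ℂ)) : modNorm g 1 u = ∫⁻ z, ‖stft g u z‖ₑ :=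
  eLpNorm_one_eq_lintegral_enorm

theorem mem_modSpace_one_iff (g : 𝓢(V, ℂ)) (u : 𝓢'(V, ℂ)) :
    u ∈ modSpace g 1 ↔ modNorm g 1 u < ⊤ :=
  ⟨fun h => h.2, fun h => ⟨(continuous_stft g u).aestronglyMeasurable, h⟩⟩

theorem integrable_stft_coe (g f : 𝓢(V, ℂ)) : Integrable (stft g (f : 𝓢'(V, ℂ))) := by
  obtain ⟨q, -, hq⟩ := exists_seminorm_stft_coe_le_weight' g
  exact (integrable_phaseSpaceWeight.const_mul (q f)).mono'
    (continuous_stft g _).aestronglyMeasurable (.of_forall (hq f))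

/-- The short-time Fourier transform of a Schwartz function is bounded. -/
theorem exists_seminorm_stft_coe_bound (g : 𝓢(V, ℂ)) :
    ∃ q : Seminorm ℝ 𝓢(V, ℂ), Continuous q ∧ ∀ (f : 𝓢(V, ℂ)) (z : V × V),
      ‖stft g (f : 𝓢'(V, ℂ)) z‖ ≤ q f := by
  obtain ⟨q, hq, hq'⟩ := exists_seminorm_stft_coe_le g 0
  exact ⟨q, hq, fun f z => by simpa using hq' f z⟩

theorem coe_mem_modSpace_top (g f : 𝓢(V, ℂ)) : (f : 𝓢'(V, ℂ)) ∈ modSpace g ∞ := by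
  obtain ⟨q, -, hq⟩ := exists_seminorm_stft_coe_bound g
  exact memLp_top_of_bound (continuous_stft g _).aestronglyMeasurable (q f) (.of_forall (hq f))

theorem modSpaceClosure_top_le (g : 𝓢(V, ℂ)) : modSpaceClosure g ∞ ≤ modSpace g ∞ := by
  intro u hu
  obtain ⟨f, hf, -⟩ := hu 1 one_pos
  have h := (modSpace g ∞).add_mem hf (coe_mem_modSpace_top g f)
  rwa [sub_add_cancel] at h

/-- Hermitian symmetry of the reproducing kernel; it matches the transform of the reconstruction
integrand with the integrand of the duality formula. -/
theorem stft_coe_timeFreqShift_comm (g : 𝓢(V, ℂ)) (z w : V × V) :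
    stft g (timeFreqShift z.1 z.2 g : 𝓢'(V, ℂ)) w =
      starRingEnd ℂ (stft g (timeFreqShift w.1 w.2 g : 𝓢'(V, ℂ)) z) := by
  rw [stft_coe, stft_coe, ← integral_conj]
  congr 1 with y
  rw [map_mul, Complex.conj_conj, mul_comm]

/-- Evaluation of the short-time Fourier transform as a functional of a Schwartz function. -/
def stftCoeCLM (g : 𝓢(V, ℂ)) (w : V × V) : 𝓢(V, ℂ) →L[ℂ] ℂ :=
  PointwiseConvergenceCLM.evalCLM (RingHom.id ℂ) ℂ (conjSchwartz (timeFreqShift w.1 w.2 g)) ∘L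
    toTemperedDistributionCLM V ℂ volume

theorem stftCoeCLM_apply (g f : 𝓢(V, ℂ)) (w : V × V) :
    stftCoeCLM g w f = stft g (f : 𝓢'(V, ℂ)) w := rfl

/-- Truncating the reconstruction integral to a compact subset of phase space yields a Schwartz
function. -/
theorem exists_schwartz_stft_sub_le (g : 𝓢(V, ℂ)) (hg : g ≠ 0) (u : 𝓢'(V, ℂ)) {K : Set (V × V)}
    (hK : IsCompact K) :
    ∃ f : 𝓢(V, ℂ), ∀ w, ENNReal.ofReal (energy g) * ‖stft g (u - (f : 𝓢'(V, ℂ))) w‖ₑ ≤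
      ∫⁻ z in Kᶜ, ‖stft g u z‖ₑ * ‖stft g (g : 𝓢'(V, ℂ)) (z - w)‖ₑ := by
  have hE := energy_pos hg
  -- For a general `u` there is no decay, but over a compact set continuity in each seminorm already
  -- gives integrability.
  obtain ⟨φ, -, hU⟩ := exists_schwartz_integral (μ := (volume : Measure (V × V)).restrict K)
    (continuous_stft_smul_timeFreqShift g u) fun k n =>
      ((continuous_schwartz_seminorm k n).comp
        (continuous_stft_smul_timeFreqShift g u)).continuousOn.integrableOn_compact hK
  refine ⟨(energy g : ℂ)⁻¹ • φ, fun w => ?_⟩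
  have hEc : (energy g : ℂ) ≠ 0 := by exact_mod_cast hE.ne'
  set H : V × V → ℂ := fun z =>
    starRingEnd ℂ (stft g (timeFreqShift w.1 w.2 g : 𝓢'(V, ℂ)) z) * stft g u z with hH
  have h1 : (energy g : ℂ) * stft g u w = ∫ z, H z :=
    (integral_stft_mul_conj_stft g u (timeFreqShift w.1 w.2 g)).2.symm
  have hint : Integrable H := (integral_stft_mul_conj_stft g u (timeFreqShift w.1 w.2 g)).1
  have h2 : stft g (φ : 𝓢'(V, ℂ)) w = ∫ z in K, H z := by
    have h := (hU ((stftCoeCLM g w).restrictScalars ℝ)).2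
    refine Eq.trans h (integral_congr_ae (.of_forall fun z => ?_))
    show stftCoeCLM g w (stft g u z • timeFreqShift z.1 z.2 g) = H z
    rw [map_smul, stftCoeCLM_apply, stft_coe_timeFreqShift_comm, smul_eq_mul, mul_comm]
  have h3 : (energy g : ℂ) * stft g (u - (((energy g : ℂ)⁻¹ • φ : 𝓢(V, ℂ)) : 𝓢'(V, ℂ))) w =
      ∫ z in Kᶜ, H z := by
    have h4 : stft g (u - (((energy g : ℂ)⁻¹ • φ : 𝓢(V, ℂ)) : 𝓢'(V, ℂ))) w =
        stft g u w - (energy g : ℂ)⁻¹ * stft g (φ : 𝓢'(V, ℂ)) w := by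
      rw [map_smul]
      rfl
    rw [h4, mul_sub, mul_inv_cancel_left₀ hEc, h1, h2, setIntegral_compl hK.measurableSet hint]
  have h5 : ENNReal.ofReal (energy g) = ‖(energy g : ℂ)‖ₑ := by
    rw [← ofReal_norm, Complex.norm_real, Real.norm_of_nonneg hE.le]
  rw [h5, ← enorm_mul, h3]
  refine (enorm_integral_le_lintegral_enorm _).trans_eq (lintegral_congr fun z => ?_)
  rw [hH, enorm_mul, mul_comm]
  congr 1
  rw [← ofReal_norm, RCLike.norm_conj, norm_stft_timeFreqShift, ofReal_norm]

/-- The Schwartz space is dense in `M¹`. -/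
theorem modSpace_one_le_modSpaceClosure (g : 𝓢(V, ℂ)) (hg : g ≠ 0) :
    modSpace g 1 ≤ modSpaceClosure g 1 := by
  intro u hu ε hε
  have hE := energy_pos hg
  have hE' : ENNReal.ofReal (energy g) ≠ 0 := by simpa using hE
  have hmu : Measurable fun z => ‖stft g u z‖ₑ := (continuous_stft g u).measurable.enorm
  have hmg : Measurable fun z => ‖stft g (g : 𝓢'(V, ℂ)) z‖ₑ :=
    (continuous_stft g _).measurable.enorm
  set A : ℝ≥0∞ := ∫⁻ z, ‖stft g (g : 𝓢'(V, ℂ)) z‖ₑ with hA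
  have hAtop : A ≠ ⊤ := (integrable_stft_coe g g).2.ne
  -- This measure is finite because `u ∈ M¹`, so inner regularity gives a compact set outside which
  -- `V_g u` has small `L¹` mass.
  set ν : Measure (V × V) := volume.withDensity fun z => ‖stft g u z‖ₑ with hν
  have hνtop : IsFiniteMeasure ν := by
    refine isFiniteMeasure_withDensity ?_
    rw [← modNorm_one]
    exact ((mem_modSpace_one_iff g u).1 hu).ne
  obtain ⟨δ, hδ, hδε⟩ : ∃ δ : ℝ≥0∞, δ ≠ 0 ∧ δ * A < ENNReal.ofReal (energy g) * ε := by
    have h0 : ENNReal.ofReal (energy g) * ε ≠ 0 := mul_ne_zero hE' hε.ne'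
    obtain ⟨η, hη0, hη⟩ := exists_between (pos_iff_ne_zero.2 h0)
    -- Adding one avoids division by zero without a separate proof that `A` is positive.
    refine ⟨η / (A + 1), ?_, ?_⟩
    · exact (ENNReal.div_pos hη0.ne' (by finiteness)).ne'
    · refine lt_of_le_of_lt ?_ hη
      calc η / (A + 1) * A ≤ η / (A + 1) * (A + 1) := by gcongr; exact le_self_add
        _ = η := ENNReal.div_mul_cancel (by simp) (by finiteness)
  obtain ⟨K, -, hK, hKδ⟩ := MeasurableSet.univ.exists_isCompact_sdiff_lt
    (measure_ne_top ν Set.univ) hδ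
  obtain ⟨f, hf⟩ := exists_schwartz_stft_sub_le g hg u hK
  have hlt : modNorm g 1 (u - (f : 𝓢'(V, ℂ))) < ε := by
    rw [← ENNReal.mul_lt_mul_iff_right hE' ENNReal.ofReal_ne_top]
    refine lt_of_le_of_lt ?_ hδε
    rw [modNorm_one, ← lintegral_const_mul' _ _ ENNReal.ofReal_ne_top]
    calc ∫⁻ w, ENNReal.ofReal (energy g) * ‖stft g (u - (f : 𝓢'(V, ℂ))) w‖ₑ
        ≤ ∫⁻ w, ∫⁻ z in Kᶜ, ‖stft g u z‖ₑ * ‖stft g (g : 𝓢'(V, ℂ)) (z - w)‖ₑ :=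
          lintegral_mono hf
      _ = ∫⁻ z in Kᶜ, ∫⁻ w, ‖stft g u z‖ₑ * ‖stft g (g : 𝓢'(V, ℂ)) (z - w)‖ₑ := by
          refine lintegral_lintegral_swap (Measurable.aemeasurable ?_)
          exact (hmu.comp measurable_snd).mul
            (hmg.comp (measurable_snd.sub measurable_fst))
      _ = ∫⁻ z in Kᶜ, ‖stft g u z‖ₑ * A := by
          refine lintegral_congr fun z => ?_
          rw [lintegral_const_mul' _ _ enorm_ne_top,
            lintegral_sub_left_eq_self (fun w => ‖stft g (g : 𝓢'(V, ℂ)) w‖ₑ) z]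
      _ = ν Kᶜ * A := by
          rw [lintegral_mul_const _ hmu, hν, withDensity_apply _ hK.measurableSet.compl]
      _ ≤ δ * A := by
          gcongr
          rw [← Set.compl_eq_univ_sdiff] at hKδ
          exact hKδ.le
  refine ⟨f, ?_, hlt⟩
  rw [mem_modSpace_one_iff]
  exact hlt.trans_le le_top

end ModulationSpaces

/-! ### Extension of operators with integrable Gabor matrix. -/

section Extension

variable {V : Type*} [NormedAddCommGroup V] [InnerProductSpace ℝ V]
  [FiniteDimensional ℝ V] [MeasurableSpace V] [BorelSpace V]

/-- The matrix of an operator with respect to time-frequency shifts of two windows. -/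
def operatorGaborMatrix (A : 𝓢(V, ℂ) →L[ℂ] 𝓢'(V, ℂ)) (g₁ g₂ : 𝓢(V, ℂ))
    (w : (V × V) × (V × V)) : ℂ :=
  stft g₂ (A (timeFreqShift w.2.1 w.2.2 g₁)) w.1

variable (A : 𝓢(V, ℂ) →L[ℂ] 𝓢'(V, ℂ)) (g₁ g₂ : 𝓢(V, ℂ))

theorem continuous_apply_timeFreqShift (φ : 𝓢(V, ℂ)) :
    Continuous fun z : V × V => A (timeFreqShift z.1 z.2 g₁) φ :=
  (PointwiseConvergenceCLM.evalCLM (RingHom.id ℂ) ℂ φ).continuous.comp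
    (A.continuous.comp (continuous_timeFreqShift g₁))

/-- Joint measurability follows from separate continuity: in `z'` for a fixed distribution, and in
`z` because `A` is continuous for pointwise convergence. -/
theorem stronglyMeasurable_operatorGaborMatrix :
    StronglyMeasurable (operatorGaborMatrix A g₁ g₂) := by
  have h : StronglyMeasurable (Function.uncurry fun z' z : V × V =>
      stft g₂ (A (timeFreqShift z.1 z.2 g₁)) z') := by
    refine stronglyMeasurable_uncurry_of_continuous_of_stronglyMeasurable (fun z => ?_)
      fun z' => ?_
    · exact continuous_stft g₂ _
    · exact (continuous_apply_timeFreqShift A g₁ _).stronglyMeasurable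
  exact h

/-- Values of the operator on time-frequency shifts are integrable over phase space when the Gabor
matrix is integrable. -/
theorem exists_seminorm_lintegral_apply_timeFreqShift_le (hg₂ : g₂ ≠ 0)
    (hk : ∫⁻ w, ‖operatorGaborMatrix A g₁ g₂ w‖ₑ < ⊤) :
    ∃ q : Seminorm ℝ 𝓢(V, ℂ), Continuous q ∧ ∀ φ,
      ∫⁻ z : V × V, ‖A (timeFreqShift z.1 z.2 g₁) φ‖ₑ ≤ ENNReal.ofReal (q φ) := by
  have hE := energy_pos hg₂
  obtain ⟨q, hq, hq'⟩ := exists_seminorm_stft_coe_bound g₂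
  set κ := ∫⁻ w, ‖operatorGaborMatrix A g₁ g₂ w‖ₑ with hκ
  have hmeas := (stronglyMeasurable_operatorGaborMatrix A g₁ g₂).measurable.enorm
  -- A one-point index set turns the lemma on sums into rescaling a single seminorm.
  obtain ⟨r, hr, hr'⟩ := exists_seminorm_eq_mul_sum (Finset.univ : Finset Unit)
    (q := fun _ => q.comp (conjSchwartzCLM : 𝓢(V, ℂ) →L[ℝ] 𝓢(V, ℂ)).toLinearMap)
    (fun _ => hq.comp (conjSchwartzCLM : 𝓢(V, ℂ) →L[ℝ] 𝓢(V, ℂ)).continuous)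
    (C := (energy g₂)⁻¹ * κ.toReal) (by positivity)
  refine ⟨r, hr, fun φ => ?_⟩
  have hr2 : r φ = (energy g₂)⁻¹ * κ.toReal * q (conjSchwartz φ) := by
    rw [hr', Finset.univ_unique, Finset.sum_singleton]
    rfl
  have hpt : ∀ z : V × V, ENNReal.ofReal (energy g₂) * ‖A (timeFreqShift z.1 z.2 g₁) φ‖ₑ ≤
      (∫⁻ z', ‖operatorGaborMatrix A g₁ g₂ (z', z)‖ₑ) * ENNReal.ofReal (q (conjSchwartz φ)) := by
    intro z
    have h := ofReal_energy_mul_enorm_sesqPairing_le g₂ (A (timeFreqShift z.1 z.2 g₁))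
      (conjSchwartz φ)
    have h2 : sesqPairing (A (timeFreqShift z.1 z.2 g₁)) (conjSchwartz φ) =
        A (timeFreqShift z.1 z.2 g₁) φ := by
      rw [sesqPairing]
      congr 1
      ext y
      simp [conjSchwartz_apply]
    rw [h2] at h
    refine h.trans ?_
    rw [← lintegral_mul_const' _ _ ENNReal.ofReal_ne_top]
    refine lintegral_mono fun z' => ?_
    dsimp only
    gcongr
    · exact le_rfl
    · rw [← ofReal_norm]
      exact ENNReal.ofReal_le_ofReal (hq' _ _)
  have hsum : ENNReal.ofReal (energy g₂) * ∫⁻ z : V × V, ‖A (timeFreqShift z.1 z.2 g₁) φ‖ₑ ≤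
      κ * ENNReal.ofReal (q (conjSchwartz φ)) := by
    rw [← lintegral_const_mul' _ _ ENNReal.ofReal_ne_top]
    refine (lintegral_mono hpt).trans_eq ?_
    rw [lintegral_mul_const' _ _ ENNReal.ofReal_ne_top, hκ, Measure.volume_eq_prod (V × V) (V × V),
      lintegral_prod_symm _ hmeas.aemeasurable]
  have hE' : ENNReal.ofReal (energy g₂) ≠ 0 := by simpa using hE
  rw [← ENNReal.mul_le_mul_iff_right hE' ENNReal.ofReal_ne_top]
  refine hsum.trans_eq ?_
  rw [hr2, ← ENNReal.ofReal_mul hE.le, ← ENNReal.ofReal_toReal (a := κ) hk.ne,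
    ← ENNReal.ofReal_mul ENNReal.toReal_nonneg]
  congr 1
  rw [ENNReal.toReal_ofReal ENNReal.toReal_nonneg]
  field_simp

theorem enorm_stft_ae_le {g : 𝓢(V, ℂ)} (u : 𝓢'(V, ℂ)) :
    ∀ᵐ z : V × V, ‖stft g u z‖ₑ ≤ modNorm g ∞ u := by
  have h := enorm_ae_le_eLpNormEssSup (stft g u) (volume : Measure (V × V))
  rw [modNorm, eLpNorm_exponent_top]
  exact h

theorem lintegral_stft_mul_le {g : 𝓢(V, ℂ)} {u : 𝓢'(V, ℂ)} (hu : u ∈ modSpace g ∞) (k : V × V → ℂ) :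
    ∫⁻ z, ‖stft g u z * k z‖ₑ ≤ modNorm g ∞ u * ∫⁻ z, ‖k z‖ₑ := by
  have htop : modNorm g ∞ u ≠ ⊤ := hu.2.ne
  rw [← lintegral_const_mul' _ _ htop]
  refine lintegral_mono_ae ?_
  filter_upwards [enorm_stft_ae_le u] with z hz
  rw [enorm_mul]
  gcongr

/-- An operator with integrable Gabor matrix extends boundedly from the closure of the Schwartz
space in `M^∞` to `M¹`. -/
theorem exists_extension_of_integrable_operatorGaborMatrix (hg₁ : g₁ ≠ 0) (hg₂ : g₂ ≠ 0)
    (hk : ∫⁻ w, ‖operatorGaborMatrix A g₁ g₂ w‖ₑ < ⊤) :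
    ∃ T : modSpaceClosure g₁ ∞ →ₗ[ℂ] modSpaceClosure g₂ 1,
      (∀ f : 𝓢(V, ℂ),
        (T ⟨(f : 𝓢'(V, ℂ)), coe_mem_modSpaceClosure g₁ ∞ f⟩ : 𝓢'(V, ℂ)) = A f) ∧
      ∀ u : modSpaceClosure g₁ ∞,
        ENNReal.ofReal (energy g₁) * modNorm g₂ 1 (T u : 𝓢'(V, ℂ)) ≤
          (∫⁻ w, ‖operatorGaborMatrix A g₁ g₂ w‖ₑ) * modNorm g₁ ∞ (u : 𝓢'(V, ℂ)) := by
  have hE := energy_pos hg₁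
  have hEc : (energy g₁ : ℂ) ≠ 0 := by exact_mod_cast hE.ne'
  obtain ⟨q, hq, hq'⟩ := exists_seminorm_lintegral_apply_timeFreqShift_le A g₁ g₂ hg₂ hk
  have hfin : ∀ u : modSpaceClosure g₁ ∞, modNorm g₁ ∞ (u : 𝓢'(V, ℂ)) < ⊤ :=
    fun u => (modSpaceClosure_top_le g₁ u.2).2
  have hle : ∀ (u : modSpaceClosure g₁ ∞) (φ : 𝓢(V, ℂ)),
      ∫⁻ z : V × V, ‖stft g₁ (u : 𝓢'(V, ℂ)) z * A (timeFreqShift z.1 z.2 g₁) φ‖ₑ ≤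
        modNorm g₁ ∞ (u : 𝓢'(V, ℂ)) * ENNReal.ofReal (q φ) := fun u φ =>
    (lintegral_stft_mul_le (modSpaceClosure_top_le g₁ u.2) _).trans (by gcongr; exact hq' φ)
  have hint : ∀ (u : modSpaceClosure g₁ ∞) (φ : 𝓢(V, ℂ)), Integrable fun z : V × V =>
      stft g₁ (u : 𝓢'(V, ℂ)) z * A (timeFreqShift z.1 z.2 g₁) φ := fun u φ =>
    ⟨((continuous_stft g₁ _).mul (continuous_apply_timeFreqShift A g₁ φ)).aestronglyMeasurable,
      (hle u φ).trans_lt (ENNReal.mul_lt_top (hfin u) ENNReal.ofReal_lt_top)⟩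
  -- The inversion formula with `A` moved inside the integral; it makes sense for every `u` with
  -- bounded short-time Fourier transform.
  let L : modSpaceClosure g₁ ∞ → 𝓢(V, ℂ) →ₗ[ℂ] ℂ := fun u =>
    { toFun := fun φ => (energy g₁ : ℂ)⁻¹ *
        ∫ z : V × V, stft g₁ (u : 𝓢'(V, ℂ)) z * A (timeFreqShift z.1 z.2 g₁) φ
      map_add' := fun φ ψ => by
        rw [← mul_add, ← integral_add (hint u φ) (hint u ψ)]
        simp only [map_add, mul_add]
      map_smul' := fun c φ => by
        simp only [map_smul, smul_eq_mul, RingHom.id_apply, mul_left_comm _ c]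
        rw [integral_const_mul, mul_left_comm] }
  have hLc : ∀ u, Continuous (L u) := by
    intro u
    refine continuous_of_continuousAt_zero (L u) ?_
    rw [ContinuousAt, map_zero]
    refine squeeze_zero_norm (a := fun φ => (energy g₁)⁻¹ *
      ((modNorm g₁ ∞ (u : 𝓢'(V, ℂ))).toReal * q φ)) (fun φ => ?_) ?_
    · show ‖(energy g₁ : ℂ)⁻¹ * ∫ z : V × V,
        stft g₁ (u : 𝓢'(V, ℂ)) z * A (timeFreqShift z.1 z.2 g₁) φ‖ ≤ _
      rw [norm_mul, norm_inv, Complex.norm_real, Real.norm_of_nonneg hE.le]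
      gcongr
      have h := (enorm_integral_le_lintegral_enorm _).trans (hle u φ)
      rw [← ofReal_norm, ← ENNReal.ofReal_toReal (a := modNorm g₁ ∞ (u : 𝓢'(V, ℂ))) (hfin u).ne,
        ← ENNReal.ofReal_mul ENNReal.toReal_nonneg] at h
      exact (ENNReal.ofReal_le_ofReal_iff
        (mul_nonneg ENNReal.toReal_nonneg (apply_nonneg q φ))).1 h
    · have h : Continuous fun φ => (energy g₁)⁻¹ *
          ((modNorm g₁ ∞ (u : 𝓢'(V, ℂ))).toReal * q φ) :=
        continuous_const.mul (continuous_const.mul hq)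
      simpa using h.tendsto 0
  let T₀ : modSpaceClosure g₁ ∞ →ₗ[ℂ] 𝓢'(V, ℂ) :=
    { toFun := fun u => ContinuousLinearMap.toPointwiseConvergenceCLM _ _ _ _ ⟨L u, hLc u⟩
      map_add' := fun u v => by
        ext φ
        show (energy g₁ : ℂ)⁻¹ * ∫ z : V × V,
          stft g₁ ((u + v : modSpaceClosure g₁ ∞) : 𝓢'(V, ℂ)) z *
            A (timeFreqShift z.1 z.2 g₁) φ =
          (energy g₁ : ℂ)⁻¹ * (∫ z : V × V, stft g₁ (u : 𝓢'(V, ℂ)) z *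
            A (timeFreqShift z.1 z.2 g₁) φ) +
          (energy g₁ : ℂ)⁻¹ * ∫ z : V × V, stft g₁ (v : 𝓢'(V, ℂ)) z *
            A (timeFreqShift z.1 z.2 g₁) φ
        rw [← mul_add, ← integral_add (hint u φ) (hint v φ)]
        simp only [Submodule.coe_add, stft_add, Pi.add_apply, add_mul]
      map_smul' := fun c u => by
        ext φ
        show (energy g₁ : ℂ)⁻¹ * ∫ z : V × V,
          stft g₁ ((c • u : modSpaceClosure g₁ ∞) : 𝓢'(V, ℂ)) z *
            A (timeFreqShift z.1 z.2 g₁) φ =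
          c * ((energy g₁ : ℂ)⁻¹ * ∫ z : V × V, stft g₁ (u : 𝓢'(V, ℂ)) z *
            A (timeFreqShift z.1 z.2 g₁) φ)
        simp only [Submodule.coe_smul, stft_smul, Pi.smul_apply, smul_eq_mul, mul_assoc]
        rw [integral_const_mul, mul_left_comm] }
  have hT₀ : ∀ u φ, T₀ u φ = (energy g₁ : ℂ)⁻¹ *
      ∫ z : V × V, stft g₁ (u : 𝓢'(V, ℂ)) z * A (timeFreqShift z.1 z.2 g₁) φ := fun _ _ => rfl
  have hmeas := (stronglyMeasurable_operatorGaborMatrix A g₁ g₂).measurable.enorm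
  have hnorm : ∀ u, ENNReal.ofReal (energy g₁) * modNorm g₂ 1 (T₀ u) ≤
      (∫⁻ w, ‖operatorGaborMatrix A g₁ g₂ w‖ₑ) * modNorm g₁ ∞ (u : 𝓢'(V, ℂ)) := by
    intro u
    -- When the test function is a shift of `g₂`, the factor multiplying `V_{g₁}u` in the integrand
    -- is the Gabor matrix.
    have hpt : ∀ z', ENNReal.ofReal (energy g₁) * ‖stft g₂ (T₀ u) z'‖ₑ ≤
        modNorm g₁ ∞ (u : 𝓢'(V, ℂ)) * ∫⁻ z, ‖operatorGaborMatrix A g₁ g₂ (z', z)‖ₑ := by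
      intro z'
      have h5 : ENNReal.ofReal (energy g₁) = ‖(energy g₁ : ℂ)‖ₑ := by
        rw [← ofReal_norm, Complex.norm_real, Real.norm_of_nonneg hE.le]
      rw [h5, ← enorm_mul, stft, sesqPairing, hT₀, mul_inv_cancel_left₀ hEc]
      exact (enorm_integral_le_lintegral_enorm _).trans
        (lintegral_stft_mul_le (modSpaceClosure_top_le g₁ u.2) _)
    rw [modNorm_one, ← lintegral_const_mul' _ _ ENNReal.ofReal_ne_top]
    refine (lintegral_mono hpt).trans_eq ?_
    rw [lintegral_const_mul' _ _ (hfin u).ne, Measure.volume_eq_prod (V × V) (V × V),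
      lintegral_prod _ hmeas.aemeasurable, mul_comm]
  have hmem : ∀ u, T₀ u ∈ modSpaceClosure g₂ 1 := by
    intro u
    refine modSpace_one_le_modSpaceClosure g₂ hg₂ ((mem_modSpace_one_iff _ _).2 ?_)
    have h := (hnorm u).trans_lt (ENNReal.mul_lt_top hk (hfin u))
    by_contra htop
    rw [not_lt, top_le_iff] at htop
    rw [htop, ENNReal.mul_top (by simpa using hE)] at h
    exact lt_irrefl _ h
  refine ⟨T₀.codRestrict _ hmem, fun f => ?_, fun u => hnorm u⟩
  show T₀ _ = A f
  ext φ
  rw [hT₀]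
  -- For Schwartz `f`, reconstruction is applied to the continuous functional `f ↦ A f φ`.
  have h := (integral_apply_stft_smul_timeFreqShift g₁ f
    ((PointwiseConvergenceCLM.evalCLM (RingHom.id ℂ) ℂ φ ∘L A).restrictScalars ℝ)).2
  have h2 : ∀ z : V × V,
      ((PointwiseConvergenceCLM.evalCLM (RingHom.id ℂ) ℂ φ ∘L A).restrictScalars ℝ)
      (stft g₁ (f : 𝓢'(V, ℂ)) z • timeFreqShift z.1 z.2 g₁) =
      stft g₁ (f : 𝓢'(V, ℂ)) z * A (timeFreqShift z.1 z.2 g₁) φ := fun z =>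
    map_smul (PointwiseConvergenceCLM.evalCLM (RingHom.id ℂ) ℂ φ ∘L A) _ _
  simp only [h2] at h
  rw [h, inv_mul_cancel_left₀ hEc]
  rfl

end Extension

/-! ### Uniform estimates for the Taylor remainder of the phase. -/

section Remainder

theorem fderiv_const_add_clm_sub_comp_add {E F : Type*} [NormedAddCommGroup E] [NormedSpace ℝ E]
    [NormedAddCommGroup F] [NormedSpace ℝ F] {f : E → F} (hf : Differentiable ℝ f) (c : F)
    (L : E →L[ℝ] F) (z : E) :
    fderiv ℝ (fun v => c + L v - f (v + z)) = fun v => L - fderiv ℝ f (v + z) := by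
  funext v
  exact ((L.hasFDerivAt.const_add c).sub
    ((hasFDerivAt_comp_add_right z).2 (hf (v + z)).hasFDerivAt)).fderiv

variable {d : ℕ} {Φ : Rdd d → ℝ}

/-- The difference between the first order Taylor polynomial of `Φ` at `z` and `Φ`, as a function of
the displacement. -/
def taylorDefect (Φ : Rdd d → ℝ) (z v : Rdd d) : ℝ := Φ z + fderiv ℝ Φ z v - Φ (v + z)

theorem IsTame.hasTemperateGrowth_taylorDefect (hΦ : IsTame Φ) (z : Rdd d) :
    Function.HasTemperateGrowth (taylorDefect Φ z) := by
  have h1 : Function.HasTemperateGrowth fun v : Rdd d => Φ z + fderiv ℝ Φ z v :=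
    (Function.HasTemperateGrowth.const _).add (fderiv ℝ Φ z).hasTemperateGrowth
  have h2 : Function.HasTemperateGrowth fun v : Rdd d => Φ (v + z) :=
    hΦ.hasTemperateGrowth.comp
      (Function.HasTemperateGrowth.id'.add (Function.HasTemperateGrowth.const z))
  exact h1.sub h2

theorem IsTame.contDiff_taylorDefect (hΦ : IsTame Φ) (z : Rdd d) :
    ContDiff ℝ ∞ (taylorDefect Φ z) :=
  (hΦ.hasTemperateGrowth_taylorDefect z).1

theorem IsTame.fderiv_taylorDefect (hΦ : IsTame Φ) (z : Rdd d) :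
    fderiv ℝ (taylorDefect Φ z) = fun v => fderiv ℝ Φ z - fderiv ℝ Φ (v + z) :=
  fderiv_const_add_clm_sub_comp_add (hΦ.smooth.differentiable (by simp)) _ _ z

/-- The derivatives of the Taylor defect are bounded uniformly in the base point. -/
theorem IsTame.exists_norm_iteratedFDeriv_taylorDefect_le (hΦ : IsTame Φ) (n : ℕ) :
    ∃ K : ℝ, 1 ≤ K ∧ ∀ i, 1 ≤ i → i ≤ n → ∀ z v,
      ‖iteratedFDeriv ℝ i (taylorDefect Φ z) v‖ ≤ (K * (1 + ‖v‖)) ^ i := by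
  choose! C hC using hΦ.bounded
  have hC0 : ∀ i, 2 ≤ i → 0 ≤ C i := fun i hi => (norm_nonneg _).trans (hC i hi 0)
  have hd1 : ContDiff ℝ ∞ (fderiv ℝ Φ) := hΦ.smooth.fderiv_right (by simp)
  -- The range contains the index 2 whatever `n` is; absolute values are taken since `C 0` and `C 1`
  -- are arbitrary.
  set K : ℝ := 1 + ∑ i ∈ Finset.range (n + 3), |C i| with hK
  have hK1 : 1 ≤ K := le_add_of_nonneg_right (Finset.sum_nonneg fun i _ => abs_nonneg _)
  have hCK : ∀ i, i < n + 3 → C i ≤ K := fun i hi =>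
    (le_abs_self _).trans ((Finset.single_le_sum (f := fun i => |C i|)
      (fun i _ => abs_nonneg _) (Finset.mem_range.2 hi)).trans (by linarith))
  refine ⟨K, hK1, fun i hi1 hin z v => ?_⟩
  have hbase : 1 ≤ K * (1 + ‖v‖) := by nlinarith [norm_nonneg v]
  -- The growth is at most linear: the mean value theorem and the bounded Hessian handle order one,
  -- and higher orders are derivatives of `Φ`. The `i`-th power is only the shape required by the
  -- estimate for compositions.
  suffices h : ‖iteratedFDeriv ℝ i (taylorDefect Φ z) v‖ ≤ K * (1 + ‖v‖) from
    h.trans (le_self_pow₀ hbase (by omega))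
  obtain ⟨j, rfl⟩ : ∃ j, i = j + 1 := ⟨i - 1, by omega⟩
  rw [← norm_iteratedFDeriv_fderiv, hΦ.fderiv_taylorDefect]
  rcases Nat.eq_zero_or_pos j with rfl | hj
  · rw [norm_iteratedFDeriv_zero, norm_sub_rev]
    have h := Convex.norm_image_sub_le_of_norm_fderiv_le (𝕜 := ℝ) (s := Set.univ)
      (f := fderiv ℝ Φ) (C := K) (x := z) (y := v + z)
      (fun y _ => hd1.differentiable (by simp) y) (fun y _ => ?_) convex_univ trivial trivial
    · refine h.trans ?_
      rw [add_sub_cancel_right]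
      gcongr
      linarith
    · rw [← norm_iteratedFDeriv_zero (𝕜 := ℝ), norm_iteratedFDeriv_fderiv,
        norm_iteratedFDeriv_fderiv]
      exact (hC 2 le_rfl y).trans (hCK 2 (by omega))
  · have h1 : iteratedFDeriv ℝ j (fun v => fderiv ℝ Φ z - fderiv ℝ Φ (v + z)) v =
        - iteratedFDeriv ℝ j (fderiv ℝ Φ) (v + z) := by
      have h2 : ContDiff ℝ ∞ fun v : Rdd d => fderiv ℝ Φ (v + z) :=
        hd1.comp (contDiff_id.add contDiff_const)
      have h3 := iteratedFDeriv_sub_apply (𝕜 := ℝ) (i := j) (x := v)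
        (f := fun _ : Rdd d => fderiv ℝ Φ z) (g := fun v : Rdd d => fderiv ℝ Φ (v + z))
        contDiff_const.contDiffAt (h2.of_le (mod_cast le_top)).contDiffAt
      refine h3.trans ?_
      rw [iteratedFDeriv_const_of_ne (by omega), iteratedFDeriv_comp_add_right]
      simp
    rw [h1, norm_neg, norm_iteratedFDeriv_fderiv]
    refine (hC _ (by omega) _).trans ((hCK _ (by omega)).trans ?_)
    nlinarith [norm_nonneg v]

/-- The oscillating factor given by the Taylor defect. -/
def defectFactor (Φ : Rdd d → ℝ) (z v : Rdd d) : ℂ :=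
  Complex.exp (2 * Real.pi * Complex.I * (taylorDefect Φ z v : ℝ))

theorem IsTame.hasTemperateGrowth_defectFactor (hΦ : IsTame Φ) (z : Rdd d) :
    Function.HasTemperateGrowth (defectFactor Φ z) :=
  hasTemperateGrowth_cexp_two_pi.comp (hΦ.hasTemperateGrowth_taylorDefect z)

theorem IsTame.exists_norm_iteratedFDeriv_defectFactor_le (hΦ : IsTame Φ) (n : ℕ) :
    ∃ K : ℝ, 0 ≤ K ∧ ∀ i ≤ n, ∀ z v,
      ‖iteratedFDeriv ℝ i (defectFactor Φ z) v‖ ≤ K * (1 + ‖v‖) ^ n := by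
  obtain ⟨K, hK1, hK⟩ := hΦ.exists_norm_iteratedFDeriv_taylorDefect_le n
  refine ⟨n.factorial * (2 * Real.pi) ^ n * K ^ n, by positivity, fun i hi z v => ?_⟩
  have hpi : 1 ≤ 2 * Real.pi := by linarith [Real.pi_gt_three]
  have hbase : 1 ≤ K * (1 + ‖v‖) := by nlinarith [norm_nonneg v]
  have h := norm_iteratedFDeriv_comp_le (𝕜 := ℝ) (n := i) contDiff_cexp_two_pi
    (hΦ.contDiff_taylorDefect z) (mod_cast le_top) v (C := (2 * Real.pi) ^ n)
    (D := K * (1 + ‖v‖)) (fun j hj => by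
      rw [norm_iteratedFDeriv_cexp_two_pi]
      exact pow_le_pow_right₀ hpi (hj.trans hi)) (fun j hj1 hj => hK j hj1 (hj.trans hi) z v)
  refine h.trans ?_
  calc (i.factorial : ℝ) * (2 * Real.pi) ^ n * (K * (1 + ‖v‖)) ^ i
      ≤ n.factorial * (2 * Real.pi) ^ n * (K * (1 + ‖v‖)) ^ n := by
        gcongr
    _ = n.factorial * (2 * Real.pi) ^ n * K ^ n * (1 + ‖v‖) ^ n := by
        rw [mul_pow K]; ring

/-- Multiplication by the oscillating factors of the Taylor defects is bounded on the Schwartz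
space, uniformly in the base point. -/
theorem IsTame.exists_seminorm_defectFactor_le (hΦ : IsTame Φ) {p : Seminorm ℝ 𝓢(Rdd d, ℂ)}
    (hp : Continuous p) :
    ∃ q : Seminorm ℝ 𝓢(Rdd d, ℂ), Continuous q ∧ ∀ z h,
      p (smulLeftCLM ℂ (defectFactor Φ z) h) ≤ q h := by
  suffices key : ∀ k n, ∃ q : Seminorm ℝ 𝓢(Rdd d, ℂ), Continuous q ∧
      ∀ (z : Rdd d) (h : 𝓢(Rdd d, ℂ)),
      1 * SchwartzMap.seminorm ℝ k n (smulLeftCLM ℂ (defectFactor Φ z) h) ≤ q h by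
    obtain ⟨q, hq, hq'⟩ := exists_seminorm_comp_le (c := fun _ => 1) (fun _ => zero_le_one) key hp
    exact ⟨q, hq, fun z h => by simpa using hq' z h⟩
  intro k n
  choose Q hQ hQ' using fun k n => exists_seminorm_one_add_pow_mul_le (E := Rdd d) k n
  have hQ0 : ∀ k n f, 0 ≤ Q k n f := fun k n f => apply_nonneg _ _
  obtain ⟨K, hK0, hK⟩ := hΦ.exists_norm_iteratedFDeriv_defectFactor_le n
  -- Weight order `k + n` absorbs the growth `(1 + ‖v‖) ^ n` of the oscillating factor; `2 ^ n`
  -- bounds the binomial coefficients in the Leibniz rule.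
  obtain ⟨q, hq, hq'⟩ := exists_seminorm_eq_mul_sum (Finset.range (n + 1))
    (fun i => hQ (k + n) (n - i)) (C := 2 ^ n * K) (by positivity)
  refine ⟨q, hq, fun z h => ?_⟩
  rw [one_mul, hq']
  refine seminorm_le_bound ℝ k n _ (mul_nonneg (by positivity)
    (Finset.sum_nonneg fun i _ => hQ0 _ _ _)) fun v => ?_
  have hfun : (smulLeftCLM ℂ (defectFactor Φ z) h : Rdd d → ℂ) =
      fun v => defectFactor Φ z v * h v :=
    smulLeftCLM_apply (hΦ.hasTemperateGrowth_defectFactor z) h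
  have hmul := norm_iteratedFDeriv_mul_le (𝕜 := ℝ) (N := ∞) (n := n)
    (hΦ.hasTemperateGrowth_defectFactor z).1 (h.smooth ⊤) v (mod_cast le_top)
  rw [hfun]
  calc ‖v‖ ^ k * ‖iteratedFDeriv ℝ n (fun v => defectFactor Φ z v * h v) v‖
      ≤ (1 + ‖v‖) ^ k * ∑ i ∈ Finset.range (n + 1), (n.choose i : ℝ) *
          ‖iteratedFDeriv ℝ i (defectFactor Φ z) v‖ * ‖iteratedFDeriv ℝ (n - i) h v‖ := by
        gcongr
        linarith
    _ ≤ ∑ i ∈ Finset.range (n + 1), 2 ^ n * K * Q (k + n) (n - i) h := by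
        rw [Finset.mul_sum]
        refine Finset.sum_le_sum fun i hi => ?_
        have hi' : i ≤ n := by simpa [Nat.lt_succ_iff] using hi
        calc (1 + ‖v‖) ^ k * ((n.choose i : ℝ) *
              ‖iteratedFDeriv ℝ i (defectFactor Φ z) v‖ * ‖iteratedFDeriv ℝ (n - i) h v‖)
            ≤ (1 + ‖v‖) ^ k * ((2 : ℝ) ^ n *
              (K * (1 + ‖v‖) ^ n) * ‖iteratedFDeriv ℝ (n - i) h v‖) := by
              gcongr
              · exact_mod_cast Nat.choose_le_two_pow n i
              · exact hK i hi' z v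
          _ = 2 ^ n * K * ((1 + ‖v‖) ^ (k + n) * ‖iteratedFDeriv ℝ (n - i) h v‖) := by
              rw [pow_add]; ring
          _ ≤ _ := by
              gcongr
              exact hQ' _ _ _ _
    _ = _ := by rw [Finset.mul_sum]

end Remainder

/-! ### Gabor matrix entries as short-time Fourier transforms of the symbol. -/

section FioOperator

variable {d : ℕ}

/-- The exchange of the two variables in `ℝ^{2d}`. -/
def swapRdd (d : ℕ) : Rdd d ≃L[ℝ] Rdd d :=
  ((WithLp.prodContinuousLinearEquiv 2 ℝ (Rd d) (Rd d)).trans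
    (ContinuousLinearEquiv.prodComm ℝ (Rd d) (Rd d))).trans
    (WithLp.prodContinuousLinearEquiv 2 ℝ (Rd d) (Rd d)).symm

/-- `tensorCLM` gives continuity in one factor only; exchanging the variables gives it in the other,
as needed for continuity of `f ↦ T_σ f`. -/
theorem tensorCLM_eq_swap (φ ψ : 𝓢(Rd d, ℂ)) :
    tensorCLM ψ φ = compCLMOfContinuousLinearEquiv ℂ (swapRdd d) (tensorCLM φ ψ) := by
  ext z
  rw [compCLMOfContinuousLinearEquiv_apply, tensorCLM_apply, Function.comp_apply, tensorCLM_apply,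
    mul_comm]
  rfl

/-- The Fourier integral operator as a continuous linear map. -/
def fioCLM (Φ : Rdd d → ℝ) (σ : 𝓢'(Rdd d, ℂ)) : 𝓢(Rd d, ℂ) →L[ℂ] 𝓢'(Rd d, ℂ) where
  toFun f := fio Φ σ f
  map_add' f g := by
    ext φ
    have h : tensorCLM (𝓕 (f + g)) φ = tensorCLM (𝓕 f) φ + tensorCLM (𝓕 g) φ := by
      ext z
      simp [FourierTransform.fourier_add, mul_add]
    show fio Φ σ (f + g) φ = fio Φ σ f φ + fio Φ σ g φ
    rw [fio_apply, h, map_add, map_add]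
    rfl
  map_smul' c f := by
    ext φ
    have h : tensorCLM (𝓕 (c • f)) φ = c • tensorCLM (𝓕 f) φ := by
      ext z
      simp [FourierTransform.fourier_smul, mul_left_comm]
    show fio Φ σ (c • f) φ = c • fio Φ σ f φ
    rw [fio_apply, h, map_smul, map_smul]
    rfl
  cont := by
    refine PointwiseConvergenceCLM.continuous_of_continuous_eval fun φ => ?_
    have h : (fun f => fio Φ σ f φ) = fun f => σ (smulLeftCLM ℂ (phaseFactor Φ)
        (compCLMOfContinuousLinearEquiv ℂ (swapRdd d) (tensorCLM φ
          (FourierTransform.fourierCLM ℂ 𝓢(Rd d, ℂ) f)))) := by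
      funext f
      rw [fio_apply, tensorCLM_eq_swap]
      rfl
    show Continuous fun f => fio Φ σ f φ
    rw [h]
    exact (map_continuous σ).comp ((smulLeftCLM ℂ (phaseFactor Φ)).continuous.comp
      ((compCLMOfContinuousLinearEquiv ℂ (swapRdd d)).continuous.comp
      ((tensorCLM φ).continuous.comp (FourierTransform.fourierCLM ℂ 𝓢(Rd d, ℂ)).continuous)))

theorem fourier_timeFreqShift_apply {V : Type*} [NormedAddCommGroup V] [InnerProductSpace ℝ V]
    [FiniteDimensional ℝ V] [MeasurableSpace V] [BorelSpace V] (x η : V) (g : 𝓢(V, ℂ)) (ν : V) :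
    𝓕 (timeFreqShift x η g) ν =
      Complex.exp (2 * Real.pi * Complex.I * (inner ℝ x (η - ν) : ℝ)) * 𝓕 g (ν - η) := by
  rw [fourier_coe, fourier_coe, Real.fourier_eq', Real.fourier_eq',
    ← integral_add_right_eq_self _ x, ← integral_const_mul]
  congr 1 with v
  rw [timeFreqShift_apply, add_sub_cancel_right, smul_eq_mul, smul_eq_mul, ← mul_assoc, ← mul_assoc,
    ← Complex.exp_add, ← Complex.exp_add]
  congr 2
  simp only [inner_add_left, inner_sub_right]
  push_cast
  ring

/-- The frequency at which an entry of the Gabor matrix of a Fourier integral operator samples the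
short-time Fourier transform of the symbol. -/
def gaborFrequency (Φ : Rdd d → ℝ) (w : (Rd d × Rd d) × (Rd d × Rd d)) : Rdd d :=
  WithLp.toLp 2 (w.1.2, w.2.1) -
    (InnerProductSpace.toDual ℝ (Rdd d)).symm (fderiv ℝ Φ (WithLp.toLp 2 (w.1.1, w.2.2)))

/-- Entries of the Gabor matrix of a Fourier integral operator are short-time Fourier transforms of
the symbol with windows that depend on the position. -/
theorem IsTame.norm_gaborMatrix_eq {Φ : Rdd d → ℝ} (hΦ : IsTame Φ) (σ : 𝓢'(Rdd d, ℂ))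
    (g₁ g₂ : 𝓢(Rd d, ℂ)) (w : (Rd d × Rd d) × (Rd d × Rd d)) :
    ‖gaborMatrix Φ σ g₁ g₂ w‖ = ‖stft (smulLeftCLM ℂ (defectFactor Φ (WithLp.toLp 2 (w.1.1, w.2.2)))
      (tensorCLM (conjSchwartz (𝓕 g₁)) g₂)) σ
      (WithLp.toLp 2 (w.1.1, w.2.2), gaborFrequency Φ w)‖ := by
  obtain ⟨⟨x', η'⟩, x, η⟩ := w
  set z : Rdd d := WithLp.toLp 2 (x', η) with hz
  set ζ := gaborFrequency Φ ((x', η'), x, η) with hζ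
  set B := smulLeftCLM ℂ (defectFactor Φ z) (tensorCLM (conjSchwartz (𝓕 g₁)) g₂) with hB
  -- All the phase terms that do not depend on the integration point.
  set c : ℝ := inner ℝ x η + Φ z - fderiv ℝ Φ z z with hc
  have hfun : smulLeftCLM ℂ (phaseFactor Φ) (tensorCLM (𝓕 (timeFreqShift x η g₁))
      (conjSchwartz (timeFreqShift x' η' g₂))) =
      Complex.exp (2 * Real.pi * Complex.I * (c : ℝ)) • conjSchwartz (timeFreqShift z ζ B) := by
    ext p
    rw [smulLeftCLM_apply_apply hΦ.phaseFactor_hasTemperateGrowth, tensorCLM_apply,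
      conjSchwartz_apply, timeFreqShift_apply, fourier_timeFreqShift_apply, smul_apply,
      conjSchwartz_apply, timeFreqShift_apply, hB,
      smulLeftCLM_apply_apply (hΦ.hasTemperateGrowth_defectFactor z), tensorCLM_apply,
      conjSchwartz_apply]
    simp only [phaseFactor, defectFactor, smul_eq_mul, map_mul, ← Complex.exp_conj,
      Complex.conj_ofReal, Complex.conj_I, map_ofNat, Complex.conj_conj]
    have h1 : (p - z).fst = p.fst - x' := rfl
    have h2 : (p - z).snd = p.snd - η := rfl
    rw [h1, h2]
    -- Taylor expansion of `Φ p` at `z`: the linear part enters `ζ` and the remainder enters the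
    -- window. The defect is minus the remainder because the window is conjugated in the pairing.
    have hexp : Complex.exp (2 * Real.pi * Complex.I * (Φ p : ℝ)) *
        (Complex.exp (2 * Real.pi * -Complex.I * (inner ℝ p.fst η' : ℝ)) *
          Complex.exp (2 * Real.pi * Complex.I * (inner ℝ x (η - p.snd) : ℝ))) =
        Complex.exp (2 * Real.pi * Complex.I * (c : ℝ)) *
        (Complex.exp (2 * Real.pi * -Complex.I * (inner ℝ p ζ : ℝ)) *
          Complex.exp (2 * Real.pi * -Complex.I * (taylorDefect Φ z (p - z) : ℝ))) := by
      simp only [← Complex.exp_add]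
      congr 1
      have hin : inner ℝ p ζ = inner ℝ p.fst η' + inner ℝ p.snd x - fderiv ℝ Φ z p := by
        rw [hζ, gaborFrequency, inner_sub_right, ← hz, WithLp.prod_inner_apply,
          ← InnerProductSpace.toDual_symm_apply (y := fderiv ℝ Φ z) (x := p),
          real_inner_comm p ((InnerProductSpace.toDual ℝ (Rdd d)).symm (fderiv ℝ Φ z))]
        rfl
      rw [hin, hc, taylorDefect, sub_add_cancel, map_sub, inner_sub_right, real_inner_comm x p.snd]
      push_cast
      ring
    linear_combination (starRingEnd ℂ (g₂ (p.fst - x')) * 𝓕 g₁ (p.snd - η)) * hexp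
  have h : gaborMatrix Φ σ g₁ g₂ ((x', η'), x, η) =
      Complex.exp (2 * Real.pi * Complex.I * (c : ℝ)) * stft B σ (z, ζ) := by
    show σ (smulLeftCLM ℂ (phaseFactor Φ) (tensorCLM (𝓕 (timeFreqShift x η g₁))
    (conjSchwartz (timeFreqShift x' η' g₂)))) = _
    rw [hfun, map_smul]
    rfl
  rw [h, norm_mul, norm_cexp_two_pi, one_mul]

end FioOperator

/-! ### Integrability of the Gabor matrix. -/

section FioGaborMatrix

variable {d : ℕ}

/-- Regroups `((x', η'), (x, η))` into the sampling position `p = (x', η)` and the pair `q = (η',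
x)`, which only affects the sampling frequency. -/
theorem lintegral_prod_prod_swap {X : Type*} [MeasureSpace X] [SFinite (volume : Measure X)]
    {f : (X × X) × (X × X) → ℝ≥0∞} (hf : Measurable f) :
    ∫⁻ w, f w = ∫⁻ p : X × X, ∫⁻ q : X × X, f ((p.1, q.1), (q.2, p.2)) := by
  have hg : Measurable fun r : X × X × X × X => f ((r.1, r.2.2.1), (r.2.2.2, r.2.1)) := by fun_prop
  have h1 : ∫⁻ w, f w = ∫⁻ a : X, ∫⁻ b : X, ∫⁻ c : X, ∫⁻ e : X, f ((a, b), (c, e)) := by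
    rw [Measure.volume_eq_prod (X × X) (X × X), lintegral_prod _ hf.aemeasurable,
      Measure.volume_eq_prod X X, lintegral_prod _ (Measurable.aemeasurable (by fun_prop))]
    refine lintegral_congr fun a => lintegral_congr fun b => ?_
    rw [lintegral_prod _ (Measurable.aemeasurable (by fun_prop))]
  have h2 : ∫⁻ p : X × X, ∫⁻ q : X × X, f ((p.1, q.1), (q.2, p.2)) =
      ∫⁻ a : X, ∫⁻ e : X, ∫⁻ b : X, ∫⁻ c : X, f ((a, b), (c, e)) := by
    rw [Measure.volume_eq_prod X X, lintegral_prod _ (Measurable.aemeasurable (by fun_prop))]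
    refine lintegral_congr fun a => lintegral_congr fun b => ?_
    rw [lintegral_prod _ (Measurable.aemeasurable (by fun_prop))]
  rw [h1, h2]
  refine lintegral_congr fun a => ?_
  have h3 : ∀ b : X, ∫⁻ c : X, ∫⁻ e : X, f ((a, b), (c, e)) =
      ∫⁻ e : X, ∫⁻ c : X, f ((a, b), (c, e)) := fun b =>
    lintegral_lintegral_swap (Measurable.aemeasurable (by fun_prop))
  simp only [h3]
  exact lintegral_lintegral_swap (Measurable.aemeasurable (by fun_prop))

theorem IsTame.continuous_gaborFrequency {Φ : Rdd d → ℝ} (hΦ : IsTame Φ) :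
    Continuous (gaborFrequency Φ) := by
  have h : Continuous (fderiv ℝ Φ) := hΦ.smooth.continuous_fderiv (by simp)
  unfold gaborFrequency
  refine Continuous.sub (by fun_prop) ?_
  exact (InnerProductSpace.toDual ℝ (Rdd d)).symm.continuous.comp (h.comp (by fun_prop))

theorem lintegral_toLp_sub {f : Rdd d → ℝ≥0∞} (hf : Measurable f) (a : Rdd d) :
    ∫⁻ p : Rd d × Rd d, f (a - WithLp.toLp 2 p) = ∫⁻ z, f z := by
  have h := (WithLp.volume_preserving_toLp (Rd d) (Rd d)).lintegral_comp
    (f := fun z : Rdd d => f (a - z)) (by fun_prop)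
  have := Measure.IsAddHaarMeasure.isNegInvariant_of_regular (μ := (volume : Measure (Rdd d)))
  rw [h, lintegral_sub_left_eq_self]

/-- The integral of the phase space weight along the phase space points which are sampled by the
Gabor matrix of a Fourier integral operator. -/
theorem IsTame.lintegral_phaseSpaceWeight_sub {Φ : Rdd d → ℝ} (hΦ : IsTame Φ) (v : Rdd d × Rdd d) :
    ∫⁻ w : (Rd d × Rd d) × (Rd d × Rd d), ENNReal.ofReal
      (phaseSpaceWeight (v - (WithLp.toLp 2 (w.1.1, w.2.2), gaborFrequency Φ w))) =
    ∫⁻ z : Rdd d × Rdd d, ENNReal.ofReal (phaseSpaceWeight z) := by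
  have hW : Measurable fun z : Rdd d × Rdd d => ENNReal.ofReal (phaseSpaceWeight z) :=
    continuous_phaseSpaceWeight.measurable.ennreal_ofReal
  have hZ : Continuous fun w : (Rd d × Rd d) × (Rd d × Rd d) =>
      v - ((WithLp.toLp 2 (w.1.1, w.2.2) : Rdd d), gaborFrequency Φ w) :=
    continuous_const.sub (Continuous.prodMk (by fun_prop) hΦ.continuous_gaborFrequency)
  have hWZ : Measurable fun w : (Rd d × Rd d) × (Rd d × Rd d) => ENNReal.ofReal
      (phaseSpaceWeight (v - ((WithLp.toLp 2 (w.1.1, w.2.2) : Rdd d), gaborFrequency Φ w))) :=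
    hW.comp hZ.measurable
  rw [lintegral_prod_prod_swap hWZ, Measure.volume_eq_prod (Rdd d) (Rdd d),
    lintegral_prod _ hW.aemeasurable,
    ← lintegral_toLp_sub (Measurable.lintegral_prod_right' hW) v.1]
  refine lintegral_congr fun p => ?_
  -- For fixed `p`, the gradient of `Φ` is a constant shift in the frequency variable, and the
  -- integral over `q` does not see it.
  refine Eq.trans ?_ (lintegral_toLp_sub
    (f := fun y => ENNReal.ofReal (phaseSpaceWeight (v.1 - WithLp.toLp 2 p, y)))
    (hW.comp measurable_prodMk_left) (v.2 +
      (InnerProductSpace.toDual ℝ (Rdd d)).symm (fderiv ℝ Φ (WithLp.toLp 2 (p.1, p.2)))))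
  refine lintegral_congr fun q => ?_
  congr 2
  refine Prod.ext rfl ?_
  simp only [gaborFrequency, Prod.snd_sub]
  abel

/-- The Gabor matrix of a Fourier integral operator with tame phase is dominated in `L¹` by the
symbol in `M¹`. -/
theorem IsTame.exists_lintegral_gaborMatrix_le {Φ : Rdd d → ℝ} (hΦ : IsTame Φ) (g₁ g₂ : 𝓢(Rd d, ℂ))
    {γ : 𝓢(Rdd d, ℂ)} (hγ : γ ≠ 0) :
    ∃ C : ℝ≥0, ∀ σ : 𝓢'(Rdd d, ℂ), ∫⁻ w, ‖gaborMatrix Φ σ g₁ g₂ w‖ₑ ≤ C * modNorm γ 1 σ := by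
  obtain ⟨p, hp, hp'⟩ := exists_seminorm_stft_coe_le_weight' γ
  obtain ⟨q, -, hq⟩ := hΦ.exists_seminorm_defectFactor_le hp
  set h : 𝓢(Rdd d, ℂ) := tensorCLM (conjSchwartz (𝓕 g₁)) g₂
  set W : Rdd d × Rdd d → ℝ≥0∞ := fun z => ENNReal.ofReal (phaseSpaceWeight z) with hWdef
  have hW : Measurable W := continuous_phaseSpaceWeight.measurable.ennreal_ofReal
  set L : ℝ≥0∞ := ∫⁻ z, W z with hL
  have hL' : L ≠ ⊤ := integrable_phaseSpaceWeight.lintegral_lt_top.ne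
  set E : ℝ≥0∞ := ENNReal.ofReal (energy γ) with hE
  have hE0 : E ≠ 0 := (ENNReal.ofReal_pos.2 (energy_pos hγ)).ne'
  have hE1 : E ≠ ⊤ := ENNReal.ofReal_ne_top
  set S : (Rd d × Rd d) × (Rd d × Rd d) → Rdd d × Rdd d := fun w =>
    (WithLp.toLp 2 (w.1.1, w.2.2), gaborFrequency Φ w) with hS
  have hSc : Continuous S := Continuous.prodMk (by fun_prop) hΦ.continuous_gaborFrequency
  -- `q h` bounds all the windows uniformly, `L` is the mass of the weight, and `E` comes from the
  -- duality formula for `γ`.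
  set K : ℝ≥0∞ := ENNReal.ofReal (q h) * L / E with hK
  have hK' : K ≠ ⊤ := ENNReal.div_ne_top (ENNReal.mul_ne_top ENNReal.ofReal_ne_top hL') hE0
  refine ⟨K.toNNReal, fun σ => ?_⟩
  rw [ENNReal.coe_toNNReal hK', modNorm_one]
  have hpt : ∀ w, E * ‖gaborMatrix Φ σ g₁ g₂ w‖ₑ ≤
      ∫⁻ v, ‖stft γ σ v‖ₑ * (ENNReal.ofReal (q h) * W (v - S w)) := by
    intro w
    have h1 : ‖gaborMatrix Φ σ g₁ g₂ w‖ₑ = ‖sesqPairing σ (timeFreqShift (S w).1 (S w).2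
        (smulLeftCLM ℂ (defectFactor Φ (S w).1) h))‖ₑ := by
      rw [← ofReal_norm, hΦ.norm_gaborMatrix_eq, ofReal_norm]
      rfl
    rw [h1]
    refine (ofReal_energy_mul_enorm_sesqPairing_le γ σ _).trans (lintegral_mono fun v => ?_)
    dsimp only
    gcongr
    rw [← ofReal_norm, norm_stft_timeFreqShift, hWdef, ← ENNReal.ofReal_mul (apply_nonneg _ _)]
    refine ENNReal.ofReal_le_ofReal ((hp' _ _).trans ?_)
    have h2 := phaseSpaceWeight_nonneg (v - S w)
    gcongr
    exact hq _ _
  have hm : Measurable fun w => ‖gaborMatrix Φ σ g₁ g₂ w‖ₑ :=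
    (stronglyMeasurable_operatorGaborMatrix (fioCLM Φ σ) g₁ g₂).measurable.enorm
  have hsm : Measurable fun v => ‖stft γ σ v‖ₑ := (continuous_stft γ σ).measurable.enorm
  have hsub : Measurable fun r : ((Rd d × Rd d) × (Rd d × Rd d)) × (Rdd d × Rdd d) =>
      W (r.2 - S r.1) := hW.comp (continuous_snd.sub (hSc.comp continuous_fst)).measurable
  have hmain : E * ∫⁻ w, ‖gaborMatrix Φ σ g₁ g₂ w‖ₑ ≤
      ENNReal.ofReal (q h) * L * ∫⁻ v, ‖stft γ σ v‖ₑ := by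
    rw [← lintegral_const_mul _ hm, ← lintegral_const_mul _ hsm]
    calc ∫⁻ w, E * ‖gaborMatrix Φ σ g₁ g₂ w‖ₑ
        ≤ ∫⁻ w, ∫⁻ v, ‖stft γ σ v‖ₑ * (ENNReal.ofReal (q h) * W (v - S w)) := lintegral_mono hpt
      _ = ∫⁻ v, ∫⁻ w, ‖stft γ σ v‖ₑ * (ENNReal.ofReal (q h) * W (v - S w)) :=
          lintegral_lintegral_swap
            ((hsm.comp measurable_snd).mul (hsub.const_mul _)).aemeasurable
      _ = ∫⁻ v, ENNReal.ofReal (q h) * L * ‖stft γ σ v‖ₑ := by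
          refine lintegral_congr fun v => ?_
          have hv : Measurable fun w => W (v - S w) :=
            hW.comp (continuous_const.sub hSc).measurable
          rw [lintegral_const_mul _ (hv.const_mul _), lintegral_const_mul _ hv,
            hΦ.lintegral_phaseSpaceWeight_sub v, mul_comm]
  rw [hK, ← ENNReal.mul_div_right_comm, ENNReal.le_div_iff_mul_le (Or.inl hE0) (Or.inl hE1),
    mul_comm]
  exact hmain

end FioGaborMatrix

end

/-! ### Both conclusions with a single constant. -/

theorem propositionM1 {d : ℕ} (Φ : Rdd d → ℝ) (hΦ : IsTame Φ)
    (g₁ g₂ : 𝓢(Rd d, ℂ)) (hg₁ : g₁ ≠ 0) (hg₂ : g₂ ≠ 0)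
    (γ : 𝓢(Rdd d, ℂ)) (hγ : γ ≠ 0) :
    ∃ C : ℝ≥0, ∀ σ : 𝓢'(Rdd d, ℂ), σ ∈ modSpace γ 1 →
      (∃ T : modSpaceClosure g₁ ∞ →ₗ[ℂ] modSpaceClosure g₂ 1,
        (∀ f : 𝓢(Rd d, ℂ),
          (T ⟨(f : 𝓢'(Rd d, ℂ)), coe_mem_modSpaceClosure g₁ ∞ f⟩ : 𝓢'(Rd d, ℂ)) = fio Φ σ f) ∧
        ∀ u : modSpaceClosure g₁ ∞,
          modNorm g₂ 1 (T u : 𝓢'(Rd d, ℂ)) ≤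
            C * modNorm γ 1 σ * modNorm g₁ ∞ (u : 𝓢'(Rd d, ℂ))) ∧
      (MemLp (gaborMatrix Φ σ g₁ g₂) 1 volume ∧
        eLpNorm (gaborMatrix Φ σ g₁ g₂) 1 volume ≤ C * modNorm γ 1 σ) := by
  obtain ⟨C, hC⟩ := hΦ.exists_lintegral_gaborMatrix_le g₁ g₂ hγ
  have hE := energy_pos hg₁
  have hE0 : ENNReal.ofReal (energy g₁) ≠ 0 := (ENNReal.ofReal_pos.2 hE).ne'
  -- The first summand serves the Gabor matrix, the second the extension, whose bound carries the
  -- normalization `‖g₁‖⁻²` of the inversion formula.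
  refine ⟨C + C / (energy g₁).toNNReal, fun σ hσ => ?_⟩
  rw [mem_modSpace_one_iff] at hσ
  have hk : ∫⁻ w, ‖gaborMatrix Φ σ g₁ g₂ w‖ₑ < ⊤ :=
    (hC σ).trans_lt (ENNReal.mul_lt_top ENNReal.coe_lt_top hσ)
  rw [ENNReal.coe_add, ENNReal.coe_div (by simpa using hE)]
  refine ⟨?_, ⟨(stronglyMeasurable_operatorGaborMatrix (fioCLM Φ σ) g₁ g₂).aestronglyMeasurable,
    ?_⟩, ?_⟩
  · obtain ⟨T, hT, hT'⟩ := exists_extension_of_integrable_operatorGaborMatrix (fioCLM Φ σ) g₁ g₂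
      hg₁ hg₂ hk
    refine ⟨T, hT, fun u => ?_⟩
    calc modNorm g₂ 1 (T u : 𝓢'(Rd d, ℂ))
        ≤ C * modNorm γ 1 σ * modNorm g₁ ∞ (u : 𝓢'(Rd d, ℂ)) / ENNReal.ofReal (energy g₁) := by
          rw [ENNReal.le_div_iff_mul_le (Or.inl hE0) (Or.inl ENNReal.ofReal_ne_top), mul_comm]
          refine (hT' u).trans ?_
          gcongr
          exact hC σ
      _ = C / (energy g₁).toNNReal * modNorm γ 1 σ * modNorm g₁ ∞ (u : 𝓢'(Rd d, ℂ)) := by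
          simp only [div_eq_mul_inv, ENNReal.ofReal]
          ring
      _ ≤ _ := by
          gcongr
          exact le_add_self
  · rw [eLpNorm_one_eq_lintegral_enorm]
    exact hk
  · rw [eLpNorm_one_eq_lintegral_enorm]
    refine (hC σ).trans ?_
    gcongr
    exact le_self_add
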